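/- Let $p=p(n)\in[0,1]$ be a sequence with $p=\omega(1/n)$ and $1-p=\omega(1/n)$ as $n\to\infty$, that is, $np\to\infty$ and $n(1-p)\to\infty$. Let $A_n$ be the adjacency matrix of the Erdős–Rényi random graph $G(n,p)$ on $n$ vertices (each pair of distinct vertices is joined independently with probability $p$; the diagonal of $A_n$ is zero), let $\sigma=\sqrt{p(1-p)}$, and let $$F_n(x)=\frac1n\left|\left\{1\le j\le n:\ \lambda_j\!\left(\tfrac{1}{\sqrt n\,\sigma}A_n\right)\le x\right\}\right|,\qquad x\in\mathbb R,$$ be the empirical spectral distribution (ESD) of $\frac{1}{\sqrt n\,\sigma}A_n$, where $\lambda_1,\dots,\lambda_n$ are the eigenvalues counted with multiplicity. Let $F_{sc}(x)=\int_{-\infty}^x\rho_{sc}(t)\,dt$ be the (continuous) distribution function of the semicircle law, with density $\rho_{sc}(t)=\frac1{2\pi}\sqrt{4-t^2}$ for $t\in[-2,2]$ and $\rho_{sc}(t)=0$ otherwise. Then the ESD of $\frac{1}{\sqrt n\,\sigma}A_n$ converges in distribution to the semicircle law, both in expectation and in probability: for every $x\in\mathbb R$, $$\mathbf E\,F_n(x)\to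 F_{sc}(x)\quad\text{as } n\to\infty,$$ and for every $x\in\mathbb R$ and $\varepsilon>0$, $$\mathbf P\big(|F_n(x)-F_{sc}(x)|\ge\varepsilon\big)\to 0\quad\text{as } n\to\infty.$$ -/

import Mathlib

open MeasureTheory Filter Topology Asymptotics

noncomputable section

/-- The empirical spectral distribution function `F_M(x) = |{j : λ_j(M) ≤ x}| / n` of a real
symmetric `n × n` matrix `M`; the eigenvalues are counted with multiplicity. -/
def esd {n : ℕ} {M : Matrix (Fin n) (Fin n) ℝ} (hM : M.IsHermitian) (x : ℝ) : ℝ :=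
  ((Finset.univ.filter fun j : Fin n => hM.eigenvalues j ≤ x).card : ℝ) / n

/-- The standard deviation `σ = √(p (1 - p))` of a Bernoulli variable with parameter `p`. -/
def bernoulliSigma (p : unitInterval) : ℝ :=
  Real.sqrt ((p : ℝ) * (1 - (p : ℝ)))

open Classical in
/-- The matrix `A / (√n σ)`, where `A` is the adjacency matrix of the graph `G` on `n` vertices
and `σ = √(p (1 - p))`. -/
def scaledAdjMatrix {n : ℕ} (p : unitInterval) (G : SimpleGraph (Fin n)) :
    Matrix (Fin n) (Fin n) ℝ :=
  (1 / (Real.sqrt n * bernoulliSigma p)) • G.adjMatrix ℝ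

theorem scaledAdjMatrix_isHermitian {n : ℕ} (p : unitInterval) (G : SimpleGraph (Fin n)) :
    (scaledAdjMatrix p G).IsHermitian := by
  classical
  ext i j
  simp [scaledAdjMatrix, Matrix.conjTranspose_apply, SimpleGraph.adjMatrix_apply, G.adj_comm]

/-- The semicircle density `√(4 - x²) / (2π)`. It vanishes outside `[-2, 2]`, since `Real.sqrt` of
a negative number is `0`. -/
def semicircleDensity (x : ℝ) : ℝ :=
  1 / (2 * Real.pi) * Real.sqrt (4 - x ^ 2)

/-- The semicircle distribution: the measure on `ℝ` with density `semicircleDensity`. -/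
def semicircleLaw : Measure ℝ :=
  volume.withDensity fun x => ENNReal.ofReal (semicircleDensity x)

/-- The (continuous) distribution function of the semicircle distribution. -/
def semicircleCDF (x : ℝ) : ℝ :=
  semicircleLaw.real (Set.Iic x)

end

/-! The proof is the Stieltjes transform method. For `z` in the upper half-plane, the transform of
the semicircle law is the root `s` of `s² + z s + 1 = 0` in the unit disc
(`integral_semicircleLaw_resolvent`). It is enough that the normalized resolvent trace `m` of the
random matrix nearly solves the same equation: `m² + z m + 1 = (m - s)(m + z + s)`, and the second
factor has imaginary part at least `Im z` (`norm_sub_le_of_defect`).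

Centring the adjacency matrix off the diagonal moves `m` only by a multiple of `1 / (√n σ)`, which
tends to `0`. For the centred matrix `W` with resolvent `R`, put `Q = m² + z m + 1`. Up to a bounded
error, `n |Q|²` is a sum over pairs `i ≠ j` of `(W i j * R j i + n⁻¹ (R E R) j i) * conj Q`, where
`E` is the symmetric matrix unit of the pair (`norm_sum_pairTerm_sub_le`). With all other pairs
fixed, expand in the value `t` of the entry `W i j`: the leading part is a multiple of `t` plus a
multiple of `n⁻¹ - t²`, and both average to zero since `t` is centred with variance `1 / n`
(`norm_average_pairTerm_le`). Hence `E|Q|² → 0` (`integral_norm_semicircleDefect_sq_le`).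

Passing from transforms to distribution functions is deterministic
(`tendsto_cdf_of_tendsto_stieltjes`) and valid along any filter. Convergence in probability is
convergence along `binomialRandomFilter`, so that theorem applies directly, without subsequences.
Convergence of means follows because the ESD is bounded. -/

/-! ### The semicircle law and its Stieltjes transform. -/

/-- Writing the sine through exponentials splits the series into two geometric ones. This is the
generating function of the Chebyshev polynomials of the second kind, times `sin θ`. -/
theorem hasSum_pow_mul_sin {w : ℂ} (hw : ‖w‖ < 1) (θ : ℝ) :
    HasSum (fun k : ℕ => (-w) ^ k * Complex.sin ((k + 1) * θ))
      (Complex.sin θ / (1 + 2 * w * Complex.cos θ + w ^ 2)) := by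
  set e : ℂ := Complex.exp (θ * Complex.I) with he
  have hen : ‖e‖ = 1 := Complex.norm_exp_ofReal_mul_I θ
  have he0 : e ≠ 0 := Complex.exp_ne_zero _
  have hinv : Complex.exp (-(θ * Complex.I)) = e⁻¹ := Complex.exp_neg _
  have h1 : HasSum (fun k : ℕ => (-w * e) ^ k) (1 - -w * e)⁻¹ :=
    hasSum_geometric_of_norm_lt_one (by simpa [hen] using hw)
  have h2 : HasSum (fun k : ℕ => (-w * e⁻¹) ^ k) (1 - -w * e⁻¹)⁻¹ :=
    hasSum_geometric_of_norm_lt_one (by simpa [hen] using hw)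
  have hd1 : 1 + w * e ≠ 0 := by
    intro h
    have : ‖w * e‖ = 1 := by
      rw [show w * e = -1 by linear_combination h]; simp
    rw [norm_mul, hen] at this
    linarith
  have hd2 : e + w ≠ 0 := by
    intro h
    have : ‖w‖ = 1 := by
      rw [show w = -e by linear_combination h]; simpa using hen
    linarith
  have h3 := ((h1.mul_left e).sub (h2.mul_left e⁻¹)).mul_left (-Complex.I / 2)
  have hf : ∀ k : ℕ, (-w) ^ k * Complex.sin ((k + 1) * θ)
      = -Complex.I / 2 * (e * (-w * e) ^ k - e⁻¹ * (-w * e⁻¹) ^ k) := by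
    intro k
    have ha : Complex.exp ((k + 1) * θ * Complex.I) = e ^ (k + 1) := by
      rw [he, ← Complex.exp_nat_mul]; congr 1; push_cast; ring
    have hb : Complex.exp (-((k + 1) * θ * Complex.I)) = (e⁻¹) ^ (k + 1) := by
      rw [Complex.exp_neg, ha, inv_pow]
    simp only [Complex.sin, neg_mul (_ * _ : ℂ) Complex.I, hb, ha, mul_pow]
    ring
  have ha : Complex.sin θ / (1 + 2 * w * Complex.cos θ + w ^ 2)
      = -Complex.I / 2 * (e * (1 - -w * e)⁻¹ - e⁻¹ * (1 - -w * e⁻¹)⁻¹) := by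
    simp only [Complex.sin, Complex.cos, neg_mul (θ : ℂ) Complex.I, hinv, ← he]
    have hd : 1 + 2 * w * ((e + e⁻¹) / 2) + w ^ 2 = (1 + w * e) * (e + w) * e⁻¹ := by
      field_simp; ring
    have hd2' : 1 - -w * e⁻¹ = (e + w) * e⁻¹ := by field_simp; ring
    have hd1' : 1 + e * w ≠ 0 := by rwa [mul_comm]
    rw [hd, hd2', show 1 - -w * e = 1 + e * w by ring, mul_comm w e]
    field_simp
    ring_nf
  simpa only [hf, ha] using h3

theorem integral_sin_mul_sin_add_one (k : ℕ) :
    ∫ θ in (0 : ℝ)..Real.pi, Real.sin ((k + 1) * θ) * Real.sin θ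
      = if k = 0 then Real.pi / 2 else 0 := by
  split_ifs with hk
  · subst hk
    have := integral_sin_sq (a := 0) (b := Real.pi)
    simp only [Nat.cast_zero, zero_add, one_mul]
    simp_rw [← sq]
    rw [this]; simp
  · have h : ∀ θ : ℝ, Real.sin ((k + 1) * θ) * Real.sin θ
        = (Real.cos (k * θ) - Real.cos ((k + 2 : ℕ) * θ)) / 2 := by
      intro θ
      have e1 : (k : ℝ) * θ = (k + 1) * θ - θ := by ring
      have e2 : ((k + 2 : ℕ) : ℝ) * θ = (k + 1) * θ + θ := by push_cast; ring
      rw [e1, e2, Real.cos_sub, Real.cos_add]; ring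
    have hc : ∀ m : ℕ, m ≠ 0 → ∫ θ in (0 : ℝ)..Real.pi, Real.cos (m * θ) = 0 := by
      intro m hm
      rw [intervalIntegral.integral_comp_mul_left (fun x => Real.cos x) (by exact_mod_cast hm)]
      simp [Real.sin_nat_mul_pi]
    simp_rw [h]
    rw [intervalIntegral.integral_div, intervalIntegral.integral_sub, hc k hk, hc _ (by omega)]
    · simp
    · exact Continuous.intervalIntegrable (by fun_prop) _ _
    · exact Continuous.intervalIntegrable (by fun_prop) _ _

/-- Integrate the sine series termwise, with the geometric majorant `‖w‖ ^ k`; orthogonality of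
sines leaves only `k = 0`. -/
theorem integral_sin_sq_div {w : ℂ} (hw : ‖w‖ < 1) :
    ∫ θ in (0 : ℝ)..Real.pi,
      Complex.sin θ / (1 + 2 * w * Complex.cos θ + w ^ 2) * Complex.sin θ = (Real.pi / 2 : ℂ) := by
  have hpi := Real.pi_pos
  let f : ℕ → C(ℝ, ℂ) := fun k =>
    ⟨fun θ : ℝ => (-w) ^ k * Complex.sin ((k + 1) * θ) * Complex.sin θ, by fun_prop⟩
  have hs : Summable fun k : ℕ =>
      ‖(f k).restrict (⟨Set.uIcc 0 Real.pi, isCompact_uIcc⟩ : TopologicalSpace.Compacts ℝ)‖ := by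
    refine Summable.of_nonneg_of_le (fun _ => norm_nonneg _) (fun k => ?_)
      (summable_geometric_of_lt_one (norm_nonneg w) hw)
    refine (ContinuousMap.norm_le _ (by positivity)).2 fun θ => ?_
    have h1 : ‖Complex.sin ((k + 1) * (θ : ℝ))‖ ≤ 1 := by
      have : Complex.sin ((k + 1) * (θ : ℝ)) = (Real.sin ((k + 1) * (θ : ℝ)) : ℂ) := by
        push_cast; rfl
      rw [this, Complex.norm_real]; exact Real.abs_sin_le_one _
    have h2 : ‖Complex.sin (θ : ℝ)‖ ≤ 1 := by
      rw [← Complex.ofReal_sin, Complex.norm_real]; exact Real.abs_sin_le_one _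
    calc ‖(-w) ^ k * Complex.sin ((k + 1) * (θ : ℝ)) * Complex.sin (θ : ℝ)‖
        = ‖w‖ ^ k * ‖Complex.sin ((k + 1) * (θ : ℝ))‖ * ‖Complex.sin (θ : ℝ)‖ := by simp
      _ ≤ ‖w‖ ^ k * 1 * 1 := by gcongr
      _ = ‖w‖ ^ k := by ring
  have key := intervalIntegral.hasSum_intervalIntegral_of_summable_norm (a := 0) (b := Real.pi) hs
  have ht : ∀ θ : ℝ, ∑' k, f k θ
      = Complex.sin θ / (1 + 2 * w * Complex.cos θ + w ^ 2) * Complex.sin θ := fun θ =>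
    ((hasSum_pow_mul_sin hw θ).mul_right (Complex.sin θ)).tsum_eq
  simp_rw [ht] at key
  refine key.unique ?_
  have hi : ∀ k, ∫ θ in (0 : ℝ)..Real.pi, f k θ = if k = 0 then (Real.pi / 2 : ℂ) else 0 := by
    intro k
    have : ∀ θ : ℝ, f k θ = (-w) ^ k * ((Real.sin ((k + 1) * θ) * Real.sin θ : ℝ) : ℂ) := by
      intro θ; simp [f, mul_assoc]
    simp_rw [this]
    rw [intervalIntegral.integral_const_mul, intervalIntegral.integral_ofReal,
      integral_sin_mul_sin_add_one]
    split_ifs with hk <;> simp [hk]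
  simp_rw [hi]
  exact hasSum_ite_eq 0 _

theorem semicircleDensity_nonneg (x : ℝ) : 0 ≤ semicircleDensity x := by
  unfold semicircleDensity; positivity

theorem continuous_semicircleDensity : Continuous semicircleDensity := by
  unfold semicircleDensity; fun_prop

theorem semicircleDensity_eq_zero {x : ℝ} (hx : x ∉ Set.Ioc (-2 : ℝ) 2) :
    semicircleDensity x = 0 := by
  unfold semicircleDensity
  rw [Real.sqrt_eq_zero_of_nonpos, mul_zero]
  by_contra! h
  exact hx ⟨by nlinarith, by nlinarith⟩

/-- Substitution `t = 2 cos θ`: one sine comes from the density, the other from `dt`. -/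
theorem integral_semicircleLaw {g : ℝ → ℂ} (hg : Continuous g) :
    ∫ t, g t ∂semicircleLaw =
      2 / Real.pi * ∫ θ in (0 : ℝ)..Real.pi, g (2 * Real.cos θ) * Complex.sin θ * Complex.sin θ := by
  have hpi := Real.pi_pos
  have h1 : ∫ t, g t ∂semicircleLaw = ∫ t, semicircleDensity t • g t := by
    unfold semicircleLaw
    rw [integral_withDensity_eq_integral_toReal_smul
      (continuous_semicircleDensity.measurable.ennreal_ofReal) (by simp)]
    simp [ENNReal.toReal_ofReal (semicircleDensity_nonneg _)]
  have h2 : ∫ t, semicircleDensity t • g t = ∫ t in (-2 : ℝ)..2, semicircleDensity t • g t := by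
    rw [intervalIntegral.integral_of_le (by norm_num)]
    refine (setIntegral_eq_integral_of_forall_compl_eq_zero fun x hx => ?_).symm
    rw [semicircleDensity_eq_zero hx, zero_smul]
  have h3 := intervalIntegral.integral_deriv_smul_comp (a := 0) (b := Real.pi)
    (f := fun θ => 2 * Real.cos θ) (f' := fun θ => 2 * -Real.sin θ)
    (g := fun t => semicircleDensity t • g t)
    (fun x _ => (Real.hasDerivAt_cos x).const_mul 2) (by fun_prop)
    (continuous_semicircleDensity.smul hg)
  simp only [Real.cos_zero, mul_one, Real.cos_pi, Function.comp_apply, mul_neg] at h3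
  rw [h1, h2, intervalIntegral.integral_symm, ← h3, ← intervalIntegral.integral_neg,
    ← intervalIntegral.integral_const_mul]
  refine intervalIntegral.integral_congr fun θ hθ => ?_
  rw [Set.uIcc_of_le hpi.le] at hθ
  have hs : 0 ≤ Real.sin θ := Real.sin_nonneg_of_mem_Icc hθ
  have hd : semicircleDensity (2 * Real.cos θ) = Real.sin θ / Real.pi := by
    unfold semicircleDensity
    rw [show 4 - (2 * Real.cos θ) ^ 2 = (2 * Real.sin θ) ^ 2 by
      linear_combination -4 * Real.sin_sq_add_cos_sq θ, Real.sqrt_sq (by positivity)]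
    field_simp
  simp only [hd, Complex.real_smul]
  push_cast
  have : (Real.pi : ℂ) ≠ 0 := by exact_mod_cast hpi.ne'
  field_simp

theorem integral_semicircleLaw_inv {w : ℂ} (hw : ‖w‖ < 1) (h0 : ∀ t : ℝ, 1 + w * t + w ^ 2 ≠ 0) :
    ∫ t : ℝ, (1 + w * t + w ^ 2)⁻¹ ∂semicircleLaw = 1 := by
  rw [integral_semicircleLaw (g := fun t : ℝ => (1 + w * t + w ^ 2)⁻¹)
    (Continuous.inv₀ (by fun_prop) h0)]
  have := integral_sin_sq_div hw
  have hpi : (Real.pi : ℂ) ≠ 0 := by exact_mod_cast Real.pi_pos.ne'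
  have h2 : ∀ θ : ℝ, (1 + w * (2 * Real.cos θ : ℝ) + w ^ 2)⁻¹ * Complex.sin θ * Complex.sin θ
      = Complex.sin θ / (1 + 2 * w * Complex.cos θ + w ^ 2) * Complex.sin θ := by
    intro θ; push_cast; rw [div_eq_inv_mul]; ring_nf
  simp_rw [h2]
  rw [this]; field_simp

instance isFiniteMeasure_semicircleLaw : IsFiniteMeasure semicircleLaw := by
  refine isFiniteMeasure_withDensity_ofReal ?_
  refine (Continuous.integrable_of_hasCompactSupport continuous_semicircleDensity ?_).2
  refine HasCompactSupport.of_support_subset_isCompact (isCompact_Icc (a := (-2 : ℝ)) (b := 2)) ?_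
  intro x hx
  by_contra h
  exact hx (semicircleDensity_eq_zero fun h' => h (Set.Ioc_subset_Icc_self h'))

instance isProbabilityMeasure_semicircleLaw : IsProbabilityMeasure semicircleLaw := by
  -- At `w = 0` the integrand is `1`, so the formula gives the total mass.
  have := integral_semicircleLaw_inv (w := 0) (by simp) (by simp)
  simp only [zero_mul, add_zero, ne_eq, OfNat.ofNat_ne_zero, not_false_eq_true, zero_pow,
    inv_one, integral_const, Complex.real_smul, mul_one] at this
  have h1 : semicircleLaw.real Set.univ = 1 := by exact_mod_cast this
  refine ⟨?_⟩
  rw [← ENNReal.ofReal_toReal (measure_ne_top semicircleLaw Set.univ)]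
  change ENNReal.ofReal (semicircleLaw.real Set.univ) = 1
  simp [h1]

theorem semicircleLaw_singleton (x : ℝ) : semicircleLaw {x} = 0 :=
  withDensity_absolutelyContinuous _ _ (by simp)

/-- A root of `s² + z s + 1` inside the unit disc. -/
theorem exists_root_norm_lt_one {z : ℂ} (hz : 0 < z.im) :
    ∃ s : ℂ, s ^ 2 + z * s + 1 = 0 ∧ ‖s‖ < 1 := by
  obtain ⟨d, hd⟩ := IsAlgClosed.exists_pow_nat_eq (z ^ 2 - 4) (n := 2) (by norm_num)
  -- On the unit circle the other root would be the conjugate of `s`, making `-z = s + s'` real.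
  have key : ∀ s s' : ℂ, s ^ 2 + z * s + 1 = 0 → s * s' = 1 → s + s' = -z → ‖s‖ ≤ 1 →
      ‖s‖ < 1 := by
    intro s s' _ hp hsum hle
    refine lt_of_le_of_ne hle fun h => ?_
    have hs' : s' = (starRingEnd ℂ) s := by
      have : s * (starRingEnd ℂ) s = 1 := by
        rw [Complex.mul_conj, Complex.normSq_eq_norm_sq, h]; simp
      have h0 : s ≠ 0 := by rintro rfl; simp at h
      exact mul_left_cancel₀ h0 (hp.trans this.symm)
    have := congrArg Complex.im hsum
    rw [hs'] at this
    simp at this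
    linarith
  set s := (-z + d) / 2
  set s' := (-z - d) / 2
  have h1 : s ^ 2 + z * s + 1 = 0 := by simp only [s]; linear_combination hd / 4
  have h2 : s' ^ 2 + z * s' + 1 = 0 := by simp only [s']; linear_combination hd / 4
  have hp : s * s' = 1 := by simp only [s, s']; linear_combination -hd / 4
  have hsum : s + s' = -z := by simp only [s, s']; ring
  rcases le_total ‖s‖ 1 with h | h
  · exact ⟨s, h1, key s s' h1 hp hsum h⟩
  · refine ⟨s', h2, key s' s h2 (by rw [mul_comm]; exact hp) (by rw [add_comm]; exact hsum) ?_⟩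
    have : ‖s‖ * ‖s'‖ = 1 := by rw [← norm_mul, hp, norm_one]
    nlinarith [norm_nonneg s']

theorem ofReal_sub_ne_zero {z : ℂ} (hz : 0 < z.im) (t : ℝ) : (t : ℂ) - z ≠ 0 := by
  intro h
  have := congrArg Complex.im h
  simp at this
  linarith

/-- The Stieltjes transform of the semicircle law is the root of `s² + z s + 1` in the unit disc. -/
theorem integral_semicircleLaw_resolvent {z s : ℂ} (hz : 0 < z.im) (hs : s ^ 2 + z * s + 1 = 0)
    (hs1 : ‖s‖ < 1) : ∫ t : ℝ, ((t : ℂ) - z)⁻¹ ∂semicircleLaw = s := by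
  have h0 : s ≠ 0 := by rintro rfl; simp at hs
  -- The quadratic equation turns the generating-function denominator at `w = s` into a resolvent
  -- denominator.
  have he : ∀ t : ℝ, 1 + s * t + s ^ 2 = s * (t - z) := fun t => by linear_combination hs
  have hne := ofReal_sub_ne_zero hz
  have h := integral_semicircleLaw_inv hs1 fun t => by
    rw [he]; exact mul_ne_zero h0 (hne t)
  simp_rw [he, mul_inv] at h
  rw [integral_const_mul] at h
  rwa [inv_mul_eq_one₀ h0, eq_comm] at h

/-! ### From Stieltjes transforms to distribution functions, via the Cayley transform. -/

open scoped BoundedContinuousFunction in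
/-- The bounded continuous functions on `ℝ` whose integrals against `μ a` converge along `L` to
the integral against `ν`. -/
def integralTendstoSubmodule {α : Type*} (L : Filter α) (μ : α → Measure ℝ)
    [∀ a, IsProbabilityMeasure (μ a)] (ν : Measure ℝ) [IsProbabilityMeasure ν] :
    Submodule ℂ (ℝ →ᵇ ℂ) where
  carrier := {f | Tendsto (fun a => ∫ t, f t ∂μ a) L (𝓝 (∫ t, f t ∂ν))}
  zero_mem' := by simp [tendsto_const_nhds]
  add_mem' {f g} hf hg := by
    have h : ∀ (κ : Measure ℝ) [IsProbabilityMeasure κ],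
        ∫ t, (f + g) t ∂κ = ∫ t, f t ∂κ + ∫ t, g t ∂κ := fun κ _ =>
      integral_add (f.integrable κ) (g.integrable κ)
    simp only [Set.mem_ofPred_eq, h] at hf hg ⊢
    exact hf.add hg
  smul_mem' c f hf := by
    simp only [Set.mem_ofPred_eq, BoundedContinuousFunction.coe_smul, integral_smul] at hf ⊢
    exact hf.const_smul c

section

open scoped BoundedContinuousFunction

variable {α : Type*} {L : Filter α} {μ : α → Measure ℝ} [∀ a, IsProbabilityMeasure (μ a)]
  {ν : Measure ℝ} [IsProbabilityMeasure ν]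

theorem mem_integralTendstoSubmodule {f : ℝ →ᵇ ℂ} :
    f ∈ integralTendstoSubmodule L μ ν ↔ Tendsto (fun a => ∫ t, f t ∂μ a) L (𝓝 (∫ t, f t ∂ν)) :=
  Iff.rfl

/-- Integration against a probability measure is 1-Lipschitz in the sup norm, uniformly over the
family, so an `ε / 3` argument applies. -/
theorem isClosed_integralTendstoSubmodule :
    IsClosed (integralTendstoSubmodule L μ ν : Set (ℝ →ᵇ ℂ)) := by
  refine isClosed_of_closure_subset fun f hf => ?_
  rw [SetLike.mem_coe, mem_integralTendstoSubmodule, Metric.tendsto_nhds]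
  intro ε hε
  obtain ⟨g, hg, hfg⟩ := Metric.mem_closure_iff.1 hf (ε / 3) (by positivity)
  have hbound : ∀ (κ : Measure ℝ) [IsProbabilityMeasure κ],
      ‖∫ t, f t ∂κ - ∫ t, g t ∂κ‖ < ε / 3 := by
    intro κ _
    rw [← integral_sub (f.integrable κ) (g.integrable κ)]
    refine lt_of_le_of_lt ((f - g).norm_integral_le_norm κ) ?_
    rwa [← dist_eq_norm]
  filter_upwards [Metric.tendsto_nhds.1 (mem_integralTendstoSubmodule.1 hg) (ε / 3) (by positivity)]
    with a ha
  rw [dist_eq_norm] at ha ⊢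
  have h1 := hbound (μ a)
  have h2 := hbound ν
  calc ‖∫ t, f t ∂μ a - ∫ t, f t ∂ν‖
      = ‖(∫ t, f t ∂μ a - ∫ t, g t ∂μ a) + (∫ t, g t ∂μ a - ∫ t, g t ∂ν)
          - (∫ t, f t ∂ν - ∫ t, g t ∂ν)‖ := by congr 1; ring
    _ ≤ ‖∫ t, f t ∂μ a - ∫ t, g t ∂μ a‖ + ‖∫ t, g t ∂μ a - ∫ t, g t ∂ν‖
          + ‖∫ t, f t ∂ν - ∫ t, g t ∂ν‖ := (norm_sub_le _ _).trans (by gcongr; exact norm_add_le _ _)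
    _ < ε := by linarith

theorem star_mem_integralTendstoSubmodule {f : ℝ →ᵇ ℂ} (hf : f ∈ integralTendstoSubmodule L μ ν) :
    star f ∈ integralTendstoSubmodule L μ ν := by
  rw [mem_integralTendstoSubmodule] at hf ⊢
  have h : ∀ κ : Measure ℝ, ∫ t, (star f) t ∂κ = star (∫ t, f t ∂κ) := fun κ =>
    integral_conj (f := fun t => f t)
  simp_rw [h]
  exact hf.star

theorem norm_ofReal_sub_inv_le {z : ℂ} (hz : 0 < z.im) (t : ℝ) : ‖((t : ℂ) - z)⁻¹‖ ≤ z.im⁻¹ := by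
  rw [norm_inv]
  refine inv_anti₀ hz ?_
  have := Complex.abs_im_le_norm ((t : ℂ) - z)
  simp only [Complex.sub_im, Complex.ofReal_im, zero_sub, abs_neg] at this
  exact (le_abs_self _).trans this

open Classical in
/-- The function `t ↦ 1 / (t - z)` for `z` in the upper half-plane. -/
noncomputable def resolventBCF (z : ℂ) : ℝ →ᵇ ℂ :=
  if hz : 0 < z.im then
    .ofNormedAddCommGroup (fun t : ℝ => ((t : ℂ) - z)⁻¹)
      (Continuous.inv₀ (by fun_prop) (ofReal_sub_ne_zero hz)) z.im⁻¹ (norm_ofReal_sub_inv_le hz)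
  else 0

theorem resolventBCF_apply {z : ℂ} (hz : 0 < z.im) (t : ℝ) :
    resolventBCF z t = ((t : ℂ) - z)⁻¹ := by
  rw [resolventBCF, dif_pos hz]; rfl

theorem norm_resolventBCF_le {z : ℂ} (hz : 0 < z.im) : ‖resolventBCF z‖ ≤ z.im⁻¹ :=
  (BoundedContinuousFunction.norm_le (by positivity)).2 fun t => by
    rw [resolventBCF_apply hz]; exact norm_ofReal_sub_inv_le hz t

theorem resolventBCF_sub {z w : ℂ} (hz : 0 < z.im) (hw : 0 < w.im) :
    resolventBCF w - resolventBCF z = (w - z) • (resolventBCF w * resolventBCF z) := by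
  ext t
  simp only [BoundedContinuousFunction.coe_sub, Pi.sub_apply, BoundedContinuousFunction.coe_smul,
    BoundedContinuousFunction.coe_mul, Pi.mul_apply, resolventBCF_apply hz, resolventBCF_apply hw,
    smul_eq_mul]
  have := ofReal_sub_ne_zero hz t
  have := ofReal_sub_ne_zero hw t
  field_simp
  ring

/-- The derivative is taken in the sup norm, so that a closed subspace containing the resolvents
also contains their derivatives. -/
theorem hasDerivAt_resolventBCF {z : ℂ} (hz : 0 < z.im) :
    HasDerivAt resolventBCF (resolventBCF z ^ 2) z := by
  have hev : ∀ᶠ w in 𝓝 z, z.im / 2 < w.im :=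
    (Complex.continuous_im.tendsto z).eventually (lt_mem_nhds (by linarith))
  have hcont : Tendsto resolventBCF (𝓝 z) (𝓝 (resolventBCF z)) := by
    rw [tendsto_iff_norm_sub_tendsto_zero]
    have hlim : Tendsto (fun w : ℂ => ‖w - z‖ * ((z.im / 2)⁻¹ * z.im⁻¹)) (𝓝 z) (𝓝 0) := by
      have : Tendsto (fun w : ℂ => ‖w - z‖ * ((z.im / 2)⁻¹ * z.im⁻¹)) (𝓝 z)
          (𝓝 (‖z - z‖ * ((z.im / 2)⁻¹ * z.im⁻¹))) := by
        apply Continuous.tendsto; fun_prop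
      simpa using this
    refine squeeze_zero' (.of_forall fun _ => norm_nonneg _) ?_ hlim
    filter_upwards [hev] with w hw
    have hw0 : 0 < w.im := by linarith
    rw [resolventBCF_sub hz hw0, norm_smul]
    gcongr
    refine (norm_mul_le _ _).trans ?_
    gcongr
    · exact (norm_resolventBCF_le hw0).trans (inv_anti₀ (by positivity) hw.le)
    · exact norm_resolventBCF_le hz
  rw [hasDerivAt_iff_tendsto_slope, sq]
  refine ((hcont.mul_const _).mono_left nhdsWithin_le_nhds).congr' ?_
  filter_upwards [nhdsWithin_le_nhds hev, self_mem_nhdsWithin] with w hw hne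
  rw [slope_def_module, resolventBCF_sub hz (by linarith), smul_smul,
    inv_mul_cancel₀ (sub_ne_zero.2 hne), one_smul]

/-- Differentiating the `k`-th power in `z` gives `k` times the next power, a uniform limit of
difference quotients already in the closed submodule. -/
theorem resolventBCF_pow_mem
    (h : ∀ z : ℂ, 0 < z.im → resolventBCF z ∈ integralTendstoSubmodule L μ ν) (k : ℕ) :
    ∀ z : ℂ, 0 < z.im → resolventBCF z ^ k ∈ integralTendstoSubmodule L μ ν := by
  induction k with
  | zero =>
    intro z hz
    rw [pow_zero, mem_integralTendstoSubmodule]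
    simp [tendsto_const_nhds]
  | succ k ih =>
    intro z hz
    -- The zeroth power is constant and its derivative yields nothing; the first power is the
    -- hypothesis.
    rcases Nat.eq_zero_or_pos k with rfl | hk
    · simpa using h z hz
    have hd := (hasDerivAt_resolventBCF hz).fun_pow k
    rw [hasDerivAt_iff_tendsto_slope] at hd
    have hev : ∀ᶠ w in 𝓝[≠] z, 0 < w.im :=
      nhdsWithin_le_nhds ((Complex.continuous_im.tendsto z).eventually (lt_mem_nhds hz))
    have hmem : (k : ℝ →ᵇ ℂ) * resolventBCF z ^ (k - 1) * resolventBCF z ^ 2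
        ∈ integralTendstoSubmodule L μ ν := by
      refine isClosed_integralTendstoSubmodule.mem_of_tendsto hd ?_
      filter_upwards [hev] with w hw
      rw [slope_def_module]
      exact Submodule.smul_mem _ _ (Submodule.sub_mem _ (ih w hw) (ih z hz))
    have hk0 : (k : ℂ) ≠ 0 := by exact_mod_cast hk.ne'
    have : resolventBCF z ^ (k + 1)
        = (k : ℂ)⁻¹ • ((k : ℝ →ᵇ ℂ) * resolventBCF z ^ (k - 1) * resolventBCF z ^ 2) := by
      rw [mul_assoc, ← pow_add, show k - 1 + 2 = k + 1 by omega, ← nsmul_eq_mul,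
        ← Nat.cast_smul_eq_nsmul ℂ, smul_smul, inv_mul_cancel₀ hk0, one_smul]
    rw [this]
    exact Submodule.smul_mem _ _ hmem

/-- The Cayley transform, as a map from the line to the circle `ℝ / 2πℤ`. -/
noncomputable def cayleyMap : C(ℝ, AddCircle (2 * Real.pi)) :=
  ⟨fun t => ((2 * Real.arctan t : ℝ) : AddCircle (2 * Real.pi)),
    (AddCircle.continuous_mk' _).comp (by fun_prop)⟩

theorem toCircle_cayleyMap (t : ℝ) :
    ((cayleyMap t).toCircle : ℂ) = (1 - t ^ 2) / (1 + t ^ 2) + 2 * t / (1 + t ^ 2) * Complex.I := by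
  have hpi := Real.pi_pos.ne'
  have h0 : (0 : ℝ) < 1 + t ^ 2 := by positivity
  have h1 : 2 * Real.pi / (2 * Real.pi) * (2 * Real.arctan t) = 2 * Real.arctan t := by
    field_simp
  change ((AddCircle.toCircle ((2 * Real.arctan t : ℝ) : AddCircle (2 * Real.pi)) : Circle) : ℂ) = _
  rw [AddCircle.toCircle_apply_mk, h1, Circle.coe_exp, Complex.exp_mul_I, ← Complex.ofReal_cos,
    ← Complex.ofReal_sin, Real.cos_two_mul, Real.sin_two_mul, Real.cos_arctan, Real.sin_arctan]
  have hs := Real.sq_sqrt h0.le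
  have e1 : 2 * (1 / √(1 + t ^ 2)) ^ 2 - 1 = (1 - t ^ 2) / (1 + t ^ 2) := by
    rw [div_pow, hs]; field_simp; ring
  have e2 : 2 * (t / √(1 + t ^ 2)) * (1 / √(1 + t ^ 2)) = 2 * t / (1 + t ^ 2) := by
    rw [show 2 * (t / √(1 + t ^ 2)) * (1 / √(1 + t ^ 2)) = 2 * t / √(1 + t ^ 2) ^ 2 by
      field_simp, hs]
  rw [e1, e2]
  push_cast
  ring

/-- The circle coordinate is `(1 + it) / (1 - it)`, with pole at `-i`. Its conjugate has its pole at
`i`, hence is affine in an upper half-plane resolvent. -/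
theorem conj_toCircle_cayleyMap (t : ℝ) :
    (starRingEnd ℂ) ((cayleyMap t).toCircle : ℂ) = -1 - 2 * Complex.I * ((t : ℂ) - Complex.I)⁻¹ := by
  have h1 : (t : ℂ) - Complex.I ≠ 0 := ofReal_sub_ne_zero (by simp) t
  have h2 : (1 + t ^ 2 : ℂ) ≠ 0 := by
    have : (1 + t ^ 2 : ℝ) ≠ 0 := by positivity
    exact_mod_cast this
  rw [toCircle_cayleyMap]
  simp only [map_add, map_mul, map_div₀, map_sub, map_one, map_pow, Complex.conj_ofReal,
    map_ofNat, Complex.conj_I]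
  field_simp
  linear_combination 2 * (t : ℂ) * Complex.I_sq

instance fact_two_pi_pos : Fact (0 < 2 * Real.pi) := ⟨Real.two_pi_pos⟩

/-- Pullback of continuous functions on the circle along the Cayley transform. -/
noncomputable def cayleyPullback (f : C(AddCircle (2 * Real.pi), ℂ)) : ℝ →ᵇ ℂ :=
  (BoundedContinuousFunction.mkOfCompact f).compContinuous cayleyMap

theorem continuous_cayleyPullback : Continuous cayleyPullback :=
  (BoundedContinuousFunction.continuous_compContinuous cayleyMap).comp
    (ContinuousMap.isometryEquivBoundedOfCompact _ _).continuous

theorem cayleyPullback_fourier_neg (k : ℕ) :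
    cayleyPullback (fourier (-(k : ℤ))) = (-1 - (2 * Complex.I) • resolventBCF Complex.I) ^ k := by
  ext t
  have h : cayleyPullback (fourier (-(k : ℤ))) t = fourier (-(k : ℤ)) (cayleyMap t) := rfl
  rw [h, fourier_neg, fourier_apply, AddCircle.toCircle_zsmul, zpow_natCast, Circle.coe_pow,
    map_pow, conj_toCircle_cayleyMap]
  simp [resolventBCF_apply (z := Complex.I) (by simp)]

/-- Negative frequencies are polynomials in the resolvent at `i`, by the binomial theorem; positive
ones are their conjugates. -/
theorem cayleyPullback_fourier_mem
    (h : ∀ z : ℂ, 0 < z.im → resolventBCF z ∈ integralTendstoSubmodule L μ ν) (n : ℤ) :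
    cayleyPullback (fourier n) ∈ integralTendstoSubmodule L μ ν := by
  have hneg : ∀ k : ℕ, cayleyPullback (fourier (-(k : ℤ))) ∈ integralTendstoSubmodule L μ ν := by
    intro k
    rw [cayleyPullback_fourier_neg, sub_eq_add_neg, add_pow]
    refine Submodule.sum_mem _ fun i _ => ?_
    have : (-1 : ℝ →ᵇ ℂ) ^ i * (-((2 * Complex.I) • resolventBCF Complex.I)) ^ (k - i)
        * (k.choose i : ℝ →ᵇ ℂ)
        = ((-1) ^ i * (-(2 * Complex.I)) ^ (k - i) * (k.choose i : ℂ))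
          • resolventBCF Complex.I ^ (k - i) := by
      ext t
      simp only [BoundedContinuousFunction.coe_mul, BoundedContinuousFunction.coe_pow,
        BoundedContinuousFunction.coe_neg, BoundedContinuousFunction.coe_smul, Pi.mul_apply,
        Pi.pow_apply, Pi.neg_apply, BoundedContinuousFunction.coe_one, Pi.one_apply, smul_eq_mul,
        BoundedContinuousFunction.coe_natCast, Pi.natCast_apply]
      rw [← neg_mul, mul_pow]
      ring
    rw [this]
    exact Submodule.smul_mem _ _ (resolventBCF_pow_mem h _ _ (by simp))
  rcases Int.eq_nat_or_neg n with ⟨k, rfl | rfl⟩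
  · have : cayleyPullback (fourier (k : ℤ)) = star (cayleyPullback (fourier (-(k : ℤ)))) := by
      ext t
      change fourier (k : ℤ) (cayleyMap t) = star (fourier (-(k : ℤ)) (cayleyMap t))
      rw [fourier_neg]
      simp
    rw [this]
    exact star_mem_integralTendstoSubmodule (hneg k)
  · exact hneg k

theorem cayleyPullback_mem
    (h : ∀ z : ℂ, 0 < z.im → resolventBCF z ∈ integralTendstoSubmodule L μ ν)
    (f : C(AddCircle (2 * Real.pi), ℂ)) : cayleyPullback f ∈ integralTendstoSubmodule L μ ν := by
  have hf : f ∈ (Submodule.span ℂ (Set.range (@fourier (2 * Real.pi)))).topologicalClosure := by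
    rw [span_fourier_closure_eq_top]; trivial
  have hc : IsClosed (cayleyPullback ⁻¹' (integralTendstoSubmodule L μ ν : Set (ℝ →ᵇ ℂ))) :=
    isClosed_integralTendstoSubmodule.preimage continuous_cayleyPullback
  refine closure_minimal (fun g hg => ?_) hc hf
  refine Submodule.span_induction (p := fun g _ => cayleyPullback g ∈
    integralTendstoSubmodule L μ ν) ?_ ?_ ?_ ?_ hg
  · rintro _ ⟨n, rfl⟩
    exact cayleyPullback_fourier_mem h n
  · exact Submodule.zero_mem _
  · exact fun x y _ _ hx hy => Submodule.add_mem _ hx hy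
  · exact fun c x _ hx => Submodule.smul_mem _ c hx

/-- The preimage of `(-∞, x]` under the inverse of the Cayley transform. -/
def cayleyIic (x : ℝ) : Set (AddCircle (2 * Real.pi)) :=
  {w | (w.toCircle : ℂ).re ≠ -1 ∧ (w.toCircle : ℂ).im / (1 + (w.toCircle : ℂ).re) ≤ x}

theorem toCircle_cayleyMap_re (t : ℝ) :
    ((cayleyMap t).toCircle : ℂ).re = (1 - t ^ 2) / (1 + t ^ 2) := by
  have : ((cayleyMap t).toCircle : ℂ) = ⟨(1 - t ^ 2) / (1 + t ^ 2), 2 * t / (1 + t ^ 2)⟩ := by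
    rw [toCircle_cayleyMap, Complex.mk_eq_add_mul_I]; push_cast; rfl
  rw [this]

theorem toCircle_cayleyMap_im (t : ℝ) :
    ((cayleyMap t).toCircle : ℂ).im = 2 * t / (1 + t ^ 2) := by
  have : ((cayleyMap t).toCircle : ℂ) = ⟨(1 - t ^ 2) / (1 + t ^ 2), 2 * t / (1 + t ^ 2)⟩ := by
    rw [toCircle_cayleyMap, Complex.mk_eq_add_mul_I]; push_cast; rfl
  rw [this]

theorem toCircle_cayleyMap_re_ne (t : ℝ) : ((cayleyMap t).toCircle : ℂ).re ≠ -1 := by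
  rw [toCircle_cayleyMap_re]
  intro h
  have : (0 : ℝ) < 1 + t ^ 2 := by positivity
  rw [div_eq_iff this.ne'] at h
  linarith

theorem toCircle_cayleyMap_im_div (t : ℝ) :
    ((cayleyMap t).toCircle : ℂ).im / (1 + ((cayleyMap t).toCircle : ℂ).re) = t := by
  have : (0 : ℝ) < 1 + t ^ 2 := by positivity
  rw [toCircle_cayleyMap_re, toCircle_cayleyMap_im]
  field_simp
  ring

theorem cayleyMap_preimage_cayleyIic (x : ℝ) : cayleyMap ⁻¹' cayleyIic x = Set.Iic x := by
  ext t
  simp only [cayleyIic, Set.mem_preimage, Set.mem_ofPred_eq, toCircle_cayleyMap_im_div, Set.mem_Iic]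
  exact and_iff_right (toCircle_cayleyMap_re_ne t)

/-- The inverse Cayley coordinate is continuous away from the point at infinity, which the line
never reaches, so a point with coordinate different from `x` is interior to the set or to its
complement. -/
theorem cayleyMap_preimage_frontier_subset (x : ℝ) :
    cayleyMap ⁻¹' frontier (cayleyIic x) ⊆ {x} := by
  intro t ht
  by_contra hne
  have hcirc : Continuous fun w : AddCircle (2 * Real.pi) => (w.toCircle : ℂ) :=
    continuous_subtype_val.comp AddCircle.continuous_toCircle
  have hre : ContinuousAt (fun w : AddCircle (2 * Real.pi) => (w.toCircle : ℂ).re) (cayleyMap t) :=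
    (Complex.continuous_re.comp hcirc).continuousAt
  have him : ContinuousAt (fun w : AddCircle (2 * Real.pi) => (w.toCircle : ℂ).im) (cayleyMap t) :=
    (Complex.continuous_im.comp hcirc).continuousAt
  have hre' := hre.eventually_ne (toCircle_cayleyMap_re_ne t)
  have hdiv : ContinuousAt (fun w : AddCircle (2 * Real.pi) =>
      (w.toCircle : ℂ).im / (1 + (w.toCircle : ℂ).re)) (cayleyMap t) :=
    him.div (continuousAt_const.add hre) fun h =>
      toCircle_cayleyMap_re_ne t (by linarith)
  have htt := toCircle_cayleyMap_im_div t
  rcases lt_or_gt_of_ne (show t ≠ x from hne) with hlt | hgt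
  · have : cayleyMap t ∈ interior (cayleyIic x) := by
      rw [mem_interior_iff_mem_nhds]
      filter_upwards [hre', hdiv.eventually (gt_mem_nhds (htt.trans_lt hlt))] with w h1 h2
      exact ⟨h1, h2.le⟩
    exact ht.2 this
  · have : cayleyMap t ∈ interior (cayleyIic x)ᶜ := by
      rw [mem_interior_iff_mem_nhds]
      filter_upwards [hdiv.eventually (lt_mem_nhds (hgt.trans_eq htt.symm))] with w h2 h3
      exact absurd h3.2 (not_le.2 h2)
    rw [interior_compl] at this
    exact this ht.1

/-- Pointwise convergence of Stieltjes transforms on the upper half-plane implies convergence of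
distribution functions at the continuity points of the limit. -/
theorem tendsto_cdf_of_tendsto_stieltjes
    (h : ∀ z : ℂ, 0 < z.im → Tendsto (fun a => ∫ t : ℝ, ((t : ℂ) - z)⁻¹ ∂μ a) L
      (𝓝 (∫ t : ℝ, ((t : ℂ) - z)⁻¹ ∂ν))) {x : ℝ} (hx : ν {x} = 0) :
    Tendsto (fun a => (μ a).real (Set.Iic x)) L (𝓝 (ν.real (Set.Iic x))) := by
  have hmem : ∀ z : ℂ, 0 < z.im → resolventBCF z ∈ integralTendstoSubmodule L μ ν := by
    intro z hz
    rw [mem_integralTendstoSubmodule]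
    simp_rw [resolventBCF_apply hz]
    exact h z hz
  have hcm : Measurable cayleyMap := cayleyMap.continuous.measurable
  -- On the compact circle trigonometric polynomials are uniformly dense, so weak convergence needs
  -- no separate tightness argument.
  let μ' : α → ProbabilityMeasure (AddCircle (2 * Real.pi)) := fun a =>
    ProbabilityMeasure.map ⟨μ a, inferInstance⟩ hcm.aemeasurable
  let ν' : ProbabilityMeasure (AddCircle (2 * Real.pi)) :=
    ProbabilityMeasure.map ⟨ν, inferInstance⟩ hcm.aemeasurable
  have hconv : Tendsto μ' L (𝓝 ν') := by
    rw [ProbabilityMeasure.tendsto_iff_forall_integral_rclike_tendsto ℂ]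
    intro f
    have hi : ∀ κ : Measure ℝ, ∫ w, f w ∂(κ.map cayleyMap) = ∫ t, cayleyPullback f t ∂κ :=
      fun κ => integral_map hcm.aemeasurable f.continuous.aestronglyMeasurable
    change Tendsto (fun a => ∫ w, f w ∂((μ a).map cayleyMap)) L (𝓝 (∫ w, f w ∂(ν.map cayleyMap)))
    simp_rw [hi]
    exact cayleyPullback_mem hmem f
  have hmeas : MeasurableSet (cayleyIic x) := by
    have hcirc : Measurable fun w : AddCircle (2 * Real.pi) => (w.toCircle : ℂ) :=
      (continuous_subtype_val.comp AddCircle.continuous_toCircle).measurable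
    refine MeasurableSet.inter ?_ ?_
    · exact (measurableSet_singleton _).compl.preimage (Complex.measurable_re.comp hcirc)
    · exact measurableSet_le ((Complex.measurable_im.comp hcirc).div
        (measurable_const.add (Complex.measurable_re.comp hcirc))) measurable_const
  have hnull : (ν' : Measure (AddCircle (2 * Real.pi))) (frontier (cayleyIic x)) = 0 := by
    change (ν.map cayleyMap) _ = 0
    rw [Measure.map_apply hcm isClosed_frontier.measurableSet]
    exact measure_mono_null (cayleyMap_preimage_frontier_subset x) hx
  have hlim := ProbabilityMeasure.tendsto_measure_of_null_frontier_of_tendsto' hconv hnull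
  have hset : ∀ κ : Measure ℝ, (κ.map cayleyMap) (cayleyIic x) = κ (Set.Iic x) := fun κ => by
    rw [Measure.map_apply hcm hmeas, cayleyMap_preimage_cayleyIic]
  change Tendsto (fun a => ((μ a).map cayleyMap) (cayleyIic x)) L
    (𝓝 ((ν.map cayleyMap) (cayleyIic x))) at hlim
  simp_rw [hset] at hlim
  exact (ENNReal.tendsto_toReal (measure_ne_top _ _)).comp hlim

end

/-! ### Operator norm bounds and resolvents of symmetric matrices. -/

section

open scoped Matrix.Norms.L2Operator Matrix

variable {ι : Type*} [Fintype ι] [DecidableEq ι]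

theorem Matrix.sum_norm_sq_col_le (A : Matrix ι ι ℂ) (j : ι) :
    ∑ i, ‖A i j‖ ^ 2 ≤ ‖A‖ ^ 2 := by
  have h := A.l2_opNorm_mulVec (EuclideanSpace.single j (1 : ℂ))
  rw [PiLp.norm_single, norm_one, mul_one] at h
  have h2 := pow_le_pow_left₀ (norm_nonneg _) h 2
  rw [EuclideanSpace.norm_sq_eq] at h2
  simpa using h2

theorem Matrix.norm_apply_le_l2_opNorm (A : Matrix ι ι ℂ) (i j : ι) : ‖A i j‖ ≤ ‖A‖ := by
  refine le_of_sq_le_sq ?_ (norm_nonneg _)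
  exact (Finset.single_le_sum (f := fun i => ‖A i j‖ ^ 2) (fun _ _ => by positivity)
    (Finset.mem_univ i)).trans (A.sum_norm_sq_col_le j)

theorem Matrix.norm_trace_le (A : Matrix ι ι ℂ) : ‖A.trace‖ ≤ Fintype.card ι * ‖A‖ := by
  refine (norm_sum_le _ _).trans ?_
  refine (Finset.sum_le_sum fun i _ => A.norm_apply_le_l2_opNorm i i).trans ?_
  simp

/-- Apply `A` to the all-ones vector, of squared norm `Fintype.card ι`, and use Cauchy–Schwarz. -/
theorem Matrix.norm_sum_apply_le (A : Matrix ι ι ℂ) :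
    ‖∑ i, ∑ j, A i j‖ ≤ Fintype.card ι * ‖A‖ := by
  have h := A.l2_opNorm_mulVec (WithLp.toLp 2 fun _ => (1 : ℂ))
  have h2 := pow_le_pow_left₀ (norm_nonneg _) h 2
  rw [mul_pow, EuclideanSpace.norm_sq_eq, EuclideanSpace.norm_sq_eq] at h2
  simp [Matrix.mulVec, dotProduct] at h2
  have h3 : ‖∑ i, ∑ j, A i j‖ ^ 2 ≤ Fintype.card ι * ∑ i, ‖∑ j, A i j‖ ^ 2 := by
    refine (pow_le_pow_left₀ (norm_nonneg _) (norm_sum_le _ _) 2).trans ?_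
    exact sq_sum_le_card_mul_sum_sq
  refine le_of_sq_le_sq ?_ (by positivity)
  calc _ ≤ _ := h3
    _ ≤ Fintype.card ι * (‖A‖ ^ 2 * Fintype.card ι) := by gcongr
    _ = _ := by ring

theorem Matrix.l2_opNorm_single_le (i j : ι) : ‖Matrix.single i j (1 : ℂ)‖ ≤ 1 := by
  have h := Matrix.l2_opNorm_conjTranspose_mul_self (Matrix.single i j (1 : ℂ))
  rw [Matrix.conjTranspose_single, Matrix.single_mul_single_same, star_one, mul_one,
    ← Matrix.diagonal_single, Matrix.l2_opNorm_diagonal, Pi.norm_single, norm_one] at h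
  nlinarith [norm_nonneg (Matrix.single i j (1 : ℂ))]

/-- The matrix whose `(i, j)` and `(j, i)` entries are one. -/
def Matrix.symmSingle (R : Type*) [Semiring R] (i j : ι) : Matrix ι ι R :=
  Matrix.single i j 1 + Matrix.single j i 1

theorem Matrix.norm_symmSingle_le (i j : ι) : ‖Matrix.symmSingle ℂ i j‖ ≤ 2 := by
  refine (norm_add_le _ _).trans ?_
  linarith [Matrix.l2_opNorm_single_le i j, Matrix.l2_opNorm_single_le j i]

theorem Matrix.mul_symmSingle_mul_apply (A B : Matrix ι ι ℂ) (i j k l : ι) :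
    (A * Matrix.symmSingle ℂ i j * B) k l = A k i * B j l + A k j * B i l := by
  simp [Matrix.symmSingle, Matrix.mul_add, Matrix.mul_apply, Matrix.single_apply,
    ite_and, add_mul, Finset.sum_add_distrib]

/-- The resolvent `(M - z)⁻¹` of a real matrix at a complex number. -/
noncomputable def resolventMatrix (M : Matrix ι ι ℝ) (z : ℂ) : Matrix ι ι ℂ :=
  (M.map Complex.ofReal - z • 1)⁻¹

/-- The real orthogonal diagonalization stays valid over `ℂ` with the same eigenvalues, and in that
basis the inverse is entrywise on the diagonal. -/
theorem resolventMatrix_spectral {M : Matrix ι ι ℝ} (hM : M.IsHermitian) {z : ℂ} (hz : 0 < z.im) :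
    ∃ U : Matrix.unitaryGroup ι ℂ, resolventMatrix M z
        = (U : Matrix ι ι ℂ) * Matrix.diagonal (fun i => ((hM.eigenvalues i : ℂ) - z)⁻¹)
          * star (U : Matrix ι ι ℂ) ∧
      (M.map Complex.ofReal - z • 1) * resolventMatrix M z = 1 := by
  set V : Matrix ι ι ℝ := (hM.eigenvectorUnitary : Matrix ι ι ℝ) with hV
  set φ := Complex.ofRealHom.mapMatrix (m := ι) with hφ
  have hstar : φ (star V) = star (φ V) := by
    ext i j
    simp [hφ, Matrix.star_apply]
  have hVV : V * star V = 1 := Unitary.coe_mul_star_self hM.eigenvectorUnitary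
  have hVV' : star V * V = 1 := Unitary.coe_star_mul_self hM.eigenvectorUnitary
  have h1 : φ V * star (φ V) = 1 := by rw [← hstar, ← map_mul, hVV, map_one]
  have h2 : star (φ V) * φ V = 1 := by rw [← hstar, ← map_mul, hVV', map_one]
  have hMs : M.map Complex.ofReal
      = φ V * Matrix.diagonal (fun i => (hM.eigenvalues i : ℂ)) * star (φ V) := by
    have hs := hM.spectral_theorem
    rw [Unitary.conjStarAlgAut_apply] at hs
    have := congrArg φ hs
    rw [map_mul, map_mul, ← hV, hstar] at this
    refine this.trans ?_
    congr 2
    ext i j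
    simp [hφ, Matrix.diagonal_apply]
    split_ifs <;> simp
  have hsub : M.map Complex.ofReal - z • 1
      = φ V * Matrix.diagonal (fun i => (hM.eigenvalues i : ℂ) - z) * star (φ V) := by
    have : Matrix.diagonal (fun i => (hM.eigenvalues i : ℂ) - z)
        = Matrix.diagonal (fun i => (hM.eigenvalues i : ℂ)) - z • (1 : Matrix ι ι ℂ) := by
      ext i j
      by_cases h : i = j <;> simp [h]
    rw [this, Matrix.mul_sub, Matrix.sub_mul, ← hMs, Matrix.mul_smul, Matrix.smul_mul, mul_one, h1]
  have hmul : (M.map Complex.ofReal - z • 1) * (φ V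
      * Matrix.diagonal (fun i => ((hM.eigenvalues i : ℂ) - z)⁻¹) * star (φ V)) = 1 := by
    rw [hsub]
    calc _ = φ V * Matrix.diagonal (fun i => (hM.eigenvalues i : ℂ) - z) * (star (φ V) * φ V)
          * Matrix.diagonal (fun i => ((hM.eigenvalues i : ℂ) - z)⁻¹) * star (φ V) := by
            simp only [mul_assoc]
      _ = φ V * (Matrix.diagonal (fun i => (hM.eigenvalues i : ℂ) - z)
          * Matrix.diagonal (fun i => ((hM.eigenvalues i : ℂ) - z)⁻¹)) * star (φ V) := by
            rw [h2]; simp only [mul_assoc, mul_one]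
      _ = 1 := by
        rw [Matrix.diagonal_mul_diagonal]
        simp only [mul_inv_cancel₀ (ofReal_sub_ne_zero hz _), Matrix.diagonal_one, mul_one, h1]
  have hinv := Matrix.inv_eq_right_inv hmul
  exact ⟨⟨φ V, Matrix.mem_unitaryGroup_iff.2 h1⟩, hinv, by rw [resolventMatrix, hinv, hmul]⟩

theorem mul_resolventMatrix {M : Matrix ι ι ℝ} (hM : M.IsHermitian) {z : ℂ} (hz : 0 < z.im) :
    (M.map Complex.ofReal - z • 1) * resolventMatrix M z = 1 :=
  (resolventMatrix_spectral hM hz).choose_spec.2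

theorem resolventMatrix_mul {M : Matrix ι ι ℝ} (hM : M.IsHermitian) {z : ℂ} (hz : 0 < z.im) :
    resolventMatrix M z * (M.map Complex.ofReal - z • 1) = 1 :=
  mul_eq_one_comm.1 (mul_resolventMatrix hM hz)

theorem norm_resolventMatrix_le {M : Matrix ι ι ℝ} (hM : M.IsHermitian) {z : ℂ} (hz : 0 < z.im) :
    ‖resolventMatrix M z‖ ≤ z.im⁻¹ := by
  obtain ⟨U, hU, -⟩ := resolventMatrix_spectral hM hz
  rw [hU, ← Unitary.coe_star, CStarRing.norm_mul_coe_unitary, CStarRing.norm_coe_unitary_mul,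
    Matrix.l2_opNorm_diagonal]
  exact (pi_norm_le_iff_of_nonneg (by positivity)).2 fun i => norm_ofReal_sub_inv_le hz _

theorem trace_resolventMatrix {M : Matrix ι ι ℝ} (hM : M.IsHermitian) {z : ℂ} (hz : 0 < z.im) :
    (resolventMatrix M z).trace = ∑ i, ((hM.eigenvalues i : ℂ) - z)⁻¹ := by
  obtain ⟨U, hU, -⟩ := resolventMatrix_spectral hM hz
  rw [hU, Matrix.trace_mul_cycle, Unitary.coe_star_mul_self, one_mul, Matrix.trace_diagonal]

theorem resolventMatrix_sub {M N : Matrix ι ι ℝ} (hM : M.IsHermitian) (hN : N.IsHermitian) {z : ℂ}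
    (hz : 0 < z.im) : resolventMatrix M z - resolventMatrix N z
      = -(resolventMatrix M z * (M - N).map Complex.ofReal * resolventMatrix N z) := by
  have hsub : (M - N).map Complex.ofReal
      = (M.map Complex.ofReal - z • 1) - (N.map Complex.ofReal - z • 1) := by
    ext i j; simp
  rw [hsub, Matrix.mul_sub, Matrix.sub_mul, resolventMatrix_mul hM hz, mul_assoc,
    mul_resolventMatrix hN hz, one_mul, mul_one, neg_sub]

/-- The normalized trace of the resolvent. -/
noncomputable def stieltjes (M : Matrix ι ι ℝ) (z : ℂ) : ℂ :=
  (resolventMatrix M z).trace / Fintype.card ι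

theorem norm_stieltjes_le {M : Matrix ι ι ℝ} (hM : M.IsHermitian) {z : ℂ} (hz : 0 < z.im) :
    ‖stieltjes M z‖ ≤ z.im⁻¹ := by
  rw [stieltjes, norm_div, Complex.norm_natCast]
  refine div_le_of_le_mul₀ (by positivity) (by positivity) ?_
  rw [mul_comm]
  exact (Matrix.norm_trace_le _).trans (by gcongr; exact norm_resolventMatrix_le hM hz)

theorem stieltjes_im_nonneg {M : Matrix ι ι ℝ} (hM : M.IsHermitian) {z : ℂ} (hz : 0 < z.im) :
    0 ≤ (stieltjes M z).im := by
  rw [stieltjes, Complex.div_natCast_im, trace_resolventMatrix hM hz, Complex.im_sum]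
  refine div_nonneg (Finset.sum_nonneg fun i _ => ?_) (by positivity)
  rw [Complex.inv_im]
  simp only [Complex.sub_im, Complex.ofReal_im, zero_sub, neg_neg]
  exact div_nonneg hz.le (Complex.normSq_nonneg _)

/-- A constant perturbation of all off-diagonal entries moves the normalized trace by at most a
multiple of that constant. -/
theorem norm_stieltjes_sub_le_of_const {M N : Matrix ι ι ℝ} (hM : M.IsHermitian)
    (hN : N.IsHermitian) {z : ℂ} (hz : 0 < z.im) {c : ℝ}
    (h : ∀ i j, M i j - N i j = if i = j then 0 else c) :
    ‖stieltjes M z - stieltjes N z‖ ≤ 2 * |c| * z.im⁻¹ ^ 2 := by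
  set R := resolventMatrix M z
  set S := resolventMatrix N z
  have hR : ‖R‖ ≤ z.im⁻¹ := norm_resolventMatrix_le hM hz
  have hS : ‖S‖ ≤ z.im⁻¹ := norm_resolventMatrix_le hN hz
  have hSR : ‖S * R‖ ≤ z.im⁻¹ ^ 2 := (norm_mul_le _ _).trans (by rw [sq]; gcongr)
  have hD : (M - N).map Complex.ofReal
      = (c : ℂ) • (Matrix.of fun _ _ => (1 : ℂ)) - (c : ℂ) • (1 : Matrix ι ι ℂ) := by
    ext i j
    have := h i j
    by_cases hij : i = j
    · subst hij; simp at this; simp [this]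
    · simp [hij] at this; simp [this, hij]
  -- The perturbation is `c` times (all-ones matrix minus identity). By cyclicity its two parts give
  -- the entry sum and the trace of `S * R`, each at most `Fintype.card ι` times the operator norm.
  have ht : R.trace - S.trace = -(c * (∑ i, ∑ j, (S * R) i j - (S * R).trace)) := by
    rw [← Matrix.trace_sub, resolventMatrix_sub hM hN hz, Matrix.trace_neg,
      Matrix.trace_mul_cycle, hD, Matrix.mul_sub, Matrix.trace_sub, Matrix.mul_smul,
      Matrix.mul_smul, Matrix.trace_smul, Matrix.trace_smul, mul_one, smul_eq_mul, smul_eq_mul,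
      ← mul_sub]
    congr 3
    simp [R, S, Matrix.trace, Matrix.mul_apply]
  have hn : ‖R.trace - S.trace‖ ≤ Fintype.card ι * (2 * |c| * z.im⁻¹ ^ 2) := by
    rw [ht, norm_neg, norm_mul, Complex.norm_real, Real.norm_eq_abs]
    have h1 := (Matrix.norm_sum_apply_le (S * R)).trans
      (mul_le_mul_of_nonneg_left hSR (Nat.cast_nonneg _))
    have h2 := (Matrix.norm_trace_le (S * R)).trans
      (mul_le_mul_of_nonneg_left hSR (Nat.cast_nonneg _))
    calc _ ≤ |c| * (Fintype.card ι * z.im⁻¹ ^ 2 + Fintype.card ι * z.im⁻¹ ^ 2) := by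
          gcongr; exact (norm_sub_le _ _).trans (add_le_add h1 h2)
      _ = _ := by ring
  rw [stieltjes, stieltjes, ← sub_div, norm_div, Complex.norm_natCast]
  refine div_le_of_le_mul₀ (by positivity) (by positivity) ?_
  rw [mul_comm]; exact hn

end

/-! ### The semicircle defect and its expansion in one matrix entry. -/

section

open scoped Matrix.Norms.L2Operator Matrix ComplexConjugate

variable {ι : Type*} [Fintype ι] [DecidableEq ι]

/-- The defect of the normalized resolvent trace in the semicircle equation `m² + z m + 1 = 0`. -/
noncomputable def semicircleDefect (M : Matrix ι ι ℝ) (z : ℂ) : ℂ :=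
  stieltjes M z ^ 2 + z * stieltjes M z + 1

/-- The contribution of the pair `(i, j)` to `n |Q|²`, where `Q` is the semicircle defect. -/
noncomputable def pairTerm (M : Matrix ι ι ℝ) (z : ℂ) (i j : ι) : ℂ :=
  (M i j * resolventMatrix M z j i + (Fintype.card ι : ℂ)⁻¹ *
    (resolventMatrix M z * Matrix.symmSingle ℂ i j * resolventMatrix M z) j i)
    * conj (semicircleDefect M z)

/-- A bound for the semicircle defect, as a function of `ρ = 1 / Im z` and `r = |z|`. -/
def defectBound (ρ r : ℝ) : ℝ := ρ ^ 2 + r * ρ + 1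

/-- A Lipschitz constant for the semicircle defect. -/
def defectLip (ρ r : ℝ) : ℝ := 2 * ρ ^ 2 * (2 * ρ + r)

theorem norm_semicircleDefect_le {M : Matrix ι ι ℝ} (hM : M.IsHermitian) {z : ℂ} (hz : 0 < z.im) :
    ‖semicircleDefect M z‖ ≤ defectBound z.im⁻¹ ‖z‖ := by
  have h := norm_stieltjes_le hM hz
  unfold semicircleDefect defectBound
  refine (norm_add₃_le).trans ?_
  rw [norm_pow, norm_mul, norm_one]
  gcongr

omit [Fintype ι] in
theorem Matrix.symmSingle_isHermitian (i j : ι) : (Matrix.symmSingle ℝ i j).IsHermitian := by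
  simp [Matrix.IsHermitian, Matrix.symmSingle, add_comm]

omit [Fintype ι] in
theorem Matrix.symmSingle_map (i j : ι) :
    (Matrix.symmSingle ℝ i j).map Complex.ofReal = Matrix.symmSingle ℂ i j := by
  ext k l
  simp [Matrix.symmSingle, Matrix.single_apply, apply_ite Complex.ofReal]

variable {B : Matrix ι ι ℝ} (hB : B.IsHermitian) {z : ℂ} (hz : 0 < z.im) (i j : ι) (t : ℝ)

omit [Fintype ι] in
include hB in
theorem isHermitian_add_smul_symmSingle : (B + t • Matrix.symmSingle ℝ i j).IsHermitian := by
  refine hB.add ?_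
  rw [Matrix.IsHermitian, Matrix.conjTranspose_smul, (Matrix.symmSingle_isHermitian i j).eq]
  rfl

include hB hz in
theorem resolventMatrix_add_smul_sub :
    resolventMatrix (B + t • Matrix.symmSingle ℝ i j) z - resolventMatrix B z
      = -((t : ℂ) • (resolventMatrix (B + t • Matrix.symmSingle ℝ i j) z
          * Matrix.symmSingle ℂ i j * resolventMatrix B z)) := by
  rw [resolventMatrix_sub (isHermitian_add_smul_symmSingle hB i j t) hB hz, add_sub_cancel_left]
  have : (t • Matrix.symmSingle ℝ i j).map Complex.ofReal = (t : ℂ) • Matrix.symmSingle ℂ i j := by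
    rw [← Matrix.symmSingle_map]; ext; simp
  rw [this, Matrix.mul_smul, Matrix.smul_mul]

include hB hz in
theorem resolventMatrix_sub_add_smul :
    resolventMatrix (B + t • Matrix.symmSingle ℝ i j) z - resolventMatrix B z
      = -((t : ℂ) • (resolventMatrix B z * Matrix.symmSingle ℂ i j
          * resolventMatrix (B + t • Matrix.symmSingle ℝ i j) z)) := by
  rw [← neg_sub, resolventMatrix_sub hB (isHermitian_add_smul_symmSingle hB i j t) hz,
    sub_add_cancel_left]
  have : (-(t • Matrix.symmSingle ℝ i j)).map Complex.ofReal
      = -((t : ℂ) • Matrix.symmSingle ℂ i j) := by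
    rw [← Matrix.symmSingle_map]; ext; simp
  rw [this, Matrix.mul_neg, Matrix.neg_mul, neg_neg, Matrix.mul_smul, Matrix.smul_mul]

theorem norm_mul_symmSingle_mul_le {R S : Matrix ι ι ℂ} {a b : ℝ} (hR : ‖R‖ ≤ a) (hS : ‖S‖ ≤ b) :
    ‖R * Matrix.symmSingle ℂ i j * S‖ ≤ 2 * a * b := by
  have ha : 0 ≤ a := (norm_nonneg _).trans hR
  calc ‖R * Matrix.symmSingle ℂ i j * S‖
      ≤ ‖R‖ * ‖Matrix.symmSingle ℂ i j‖ * ‖S‖ :=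
        (norm_mul_le _ _).trans (mul_le_mul_of_nonneg_right (norm_mul_le _ _) (norm_nonneg _))
    _ ≤ a * 2 * b := by gcongr; exact Matrix.norm_symmSingle_le i j
    _ = 2 * a * b := by ring

include hB hz in
theorem norm_resolventMatrix_add_smul_sub_le :
    ‖resolventMatrix (B + t • Matrix.symmSingle ℝ i j) z - resolventMatrix B z‖
      ≤ 2 * |t| * z.im⁻¹ ^ 2 := by
  rw [resolventMatrix_add_smul_sub hB hz, norm_neg, norm_smul, Complex.norm_real, Real.norm_eq_abs]
  calc _ ≤ |t| * (2 * z.im⁻¹ * z.im⁻¹) := by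
        gcongr
        exact norm_mul_symmSingle_mul_le i j (norm_resolventMatrix_le
          (isHermitian_add_smul_symmSingle hB i j t) hz) (norm_resolventMatrix_le hB hz)
    _ = _ := by ring

include hB hz in
-- The resolvent identity used twice: the remainder is `t S E (R - S)`, and `R - S` is itself of
-- order `t`.
theorem norm_resolventMatrix_second_order_le :
    ‖resolventMatrix (B + t • Matrix.symmSingle ℝ i j) z - resolventMatrix B z
      + (t : ℂ) • (resolventMatrix B z * Matrix.symmSingle ℂ i j * resolventMatrix B z)‖
      ≤ 4 * t ^ 2 * z.im⁻¹ ^ 3 := by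
  set R := resolventMatrix (B + t • Matrix.symmSingle ℝ i j) z with hR
  set S := resolventMatrix B z with hS
  have hSn : ‖S‖ ≤ z.im⁻¹ := norm_resolventMatrix_le hB hz
  have h : R - S + (t : ℂ) • (S * Matrix.symmSingle ℂ i j * S)
      = -((t : ℂ) • (S * Matrix.symmSingle ℂ i j * (R - S))) := by
    have h1 : R - S = -((t : ℂ) • (S * Matrix.symmSingle ℂ i j * R)) :=
      resolventMatrix_sub_add_smul hB hz i j t
    rw [Matrix.mul_sub, smul_sub, h1]
    abel
  rw [h, norm_neg, norm_smul, Complex.norm_real, Real.norm_eq_abs]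
  calc _ ≤ |t| * (2 * z.im⁻¹ * (2 * |t| * z.im⁻¹ ^ 2)) := by
        gcongr
        exact norm_mul_symmSingle_mul_le i j hSn
          (norm_resolventMatrix_add_smul_sub_le hB hz i j t)
    _ = 4 * |t| ^ 2 * z.im⁻¹ ^ 3 := by ring
    _ = _ := by rw [sq_abs]

include hB hz in
-- By cyclicity the trace changes by `t` times just two entries of `S * R`, so the normalization
-- gains a full factor `1 / Fintype.card ι`.
theorem norm_stieltjes_add_smul_sub_le :
    ‖stieltjes (B + t • Matrix.symmSingle ℝ i j) z - stieltjes B z‖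
      ≤ 2 * z.im⁻¹ ^ 2 * |t| / Fintype.card ι := by
  rw [stieltjes, stieltjes, ← sub_div, norm_div, Complex.norm_natCast]
  gcongr
  set R := resolventMatrix (B + t • Matrix.symmSingle ℝ i j) z with hR
  set S := resolventMatrix B z with hS
  have hRn : ‖R‖ ≤ z.im⁻¹ :=
    norm_resolventMatrix_le (isHermitian_add_smul_symmSingle hB i j t) hz
  have hSn : ‖S‖ ≤ z.im⁻¹ := norm_resolventMatrix_le hB hz
  have hSR : ‖S * R‖ ≤ z.im⁻¹ ^ 2 := (norm_mul_le _ _).trans (by rw [sq]; gcongr)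
  have ht : (S * R * Matrix.symmSingle ℂ i j).trace = (S * R) j i + (S * R) i j := by
    simp [Matrix.symmSingle, Matrix.mul_add, Matrix.trace_mul_single]
  rw [← Matrix.trace_sub, resolventMatrix_add_smul_sub hB hz, ← hS, ← hR, Matrix.trace_neg,
    Matrix.trace_smul, Matrix.trace_mul_cycle, ht, norm_neg, norm_smul, Complex.norm_real,
    Real.norm_eq_abs]
  have h1 := ((S * R).norm_apply_le_l2_opNorm j i).trans hSR
  have h2 := ((S * R).norm_apply_le_l2_opNorm i j).trans hSR
  calc _ ≤ |t| * (z.im⁻¹ ^ 2 + z.im⁻¹ ^ 2) := by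
        gcongr; exact (norm_add_le _ _).trans (add_le_add h1 h2)
    _ = _ := by ring

include hB hz in
theorem norm_semicircleDefect_add_smul_sub_le :
    ‖semicircleDefect (B + t • Matrix.symmSingle ℝ i j) z - semicircleDefect B z‖
      ≤ defectLip z.im⁻¹ ‖z‖ * |t| / Fintype.card ι := by
  have h := norm_stieltjes_add_smul_sub_le hB hz i j t
  have h1 := norm_stieltjes_le (isHermitian_add_smul_symmSingle hB i j t) hz
  have h2 := norm_stieltjes_le hB hz
  set m := stieltjes (B + t • Matrix.symmSingle ℝ i j) z
  set m₀ := stieltjes B z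
  have hd : semicircleDefect (B + t • Matrix.symmSingle ℝ i j) z - semicircleDefect B z
      = (m - m₀) * (m + m₀ + z) := by
    simp only [semicircleDefect]; ring
  rw [hd, norm_mul]
  calc _ ≤ (2 * z.im⁻¹ ^ 2 * |t| / Fintype.card ι) * (z.im⁻¹ + z.im⁻¹ + ‖z‖) := by
        gcongr; exact norm_add₃_le.trans (by gcongr)
    _ = _ := by unfold defectLip; ring

/-- The constant in the error bound for the two-point expansion. -/
def pairConst (ρ r : ℝ) : ℝ :=
  12 * ρ ^ 3 * defectBound ρ r + (ρ + 4 * ρ ^ 2) * defectLip ρ r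

/-- Scalar form of the expansion: `a`, `b`, `x` stand for `R j i`, `(R E R) j i` and the conjugate
defect, and subscript `0` for their values at `t = 0`. Only `a` is expanded to first order; `x`
varies by `O(|t| / n)` and may be frozen. -/
theorem norm_pair_expansion_le {a a₀ b b₀ x x₀ : ℂ} {t K n ρ β l : ℝ} (hn : 1 ≤ n) (hK : K ≤ 1)
    (ht : |t| ≤ K) (hρ : 0 ≤ ρ) (hl : 0 ≤ l)
    (ha : ‖a - a₀ + t * b₀‖ ≤ 4 * t ^ 2 * ρ ^ 3) (hx : ‖x‖ ≤ β) (ha₀ : ‖a₀‖ ≤ ρ)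
    (hb₀ : ‖b₀‖ ≤ 2 * ρ ^ 2) (hb : ‖b - b₀‖ ≤ 8 * |t| * ρ ^ 3) (hxx : ‖x - x₀‖ ≤ l * |t| / n) :
    ‖(t * a + (n : ℂ)⁻¹ * b) * x - (t * (a₀ * x₀) + ((n : ℂ)⁻¹ - t ^ 2) * (b₀ * x₀))‖
      ≤ t ^ 2 * (4 * ρ ^ 3 * β * K + (ρ + 2 * ρ ^ 2) * l / n)
        + n⁻¹ * (K * (8 * ρ ^ 3 * β) + 2 * ρ ^ 2 * l / n) := by
  have h0 : (t * a + (n : ℂ)⁻¹ * b) * x - (t * (a₀ * x₀) + ((n : ℂ)⁻¹ - t ^ 2) * (b₀ * x₀))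
      = t * (a - a₀ + t * b₀) * x + t * (a₀ - t * b₀) * (x - x₀)
        + (n : ℂ)⁻¹ * (b - b₀) * x + (n : ℂ)⁻¹ * b₀ * (x - x₀) := by ring
  have hn0 : (0 : ℝ) < n := by linarith
  have htn : ‖(t : ℂ)‖ = |t| := by rw [Complex.norm_real, Real.norm_eq_abs]
  have hnn : ‖(n : ℂ)⁻¹‖ = n⁻¹ := by
    rw [norm_inv, Complex.norm_real, Real.norm_eq_abs, abs_of_pos hn0]
  have hβ : 0 ≤ β := (norm_nonneg _).trans hx
  have hK0 : 0 ≤ K := (abs_nonneg _).trans ht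
  have h1 : ‖t * (a - a₀ + t * b₀) * x‖ ≤ t ^ 2 * (4 * ρ ^ 3 * β * K) := by
    rw [norm_mul, norm_mul, htn]
    calc _ ≤ K * (4 * t ^ 2 * ρ ^ 3) * β := by gcongr
      _ = _ := by ring
  have h2 : ‖t * (a₀ - t * b₀) * (x - x₀)‖ ≤ t ^ 2 * ((ρ + 2 * ρ ^ 2) * l / n) := by
    rw [norm_mul, norm_mul, htn]
    have : ‖a₀ - t * b₀‖ ≤ ρ + 2 * ρ ^ 2 := by
      refine (norm_sub_le _ _).trans ?_
      rw [norm_mul, htn]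
      calc _ ≤ ρ + 1 * (2 * ρ ^ 2) := by gcongr; exact ht.trans hK
        _ = _ := by ring
    calc _ ≤ |t| * (ρ + 2 * ρ ^ 2) * (l * |t| / n) := by gcongr
      _ = |t| ^ 2 * ((ρ + 2 * ρ ^ 2) * l / n) := by ring
      _ = _ := by rw [sq_abs]
  have h3 : ‖(n : ℂ)⁻¹ * (b - b₀) * x‖ ≤ n⁻¹ * (K * (8 * ρ ^ 3 * β)) := by
    rw [norm_mul, norm_mul, hnn]
    calc _ ≤ n⁻¹ * (8 * K * ρ ^ 3) * β := by
          gcongr; exact hb.trans (by gcongr)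
      _ = _ := by ring
  have h4 : ‖(n : ℂ)⁻¹ * b₀ * (x - x₀)‖ ≤ n⁻¹ * (2 * ρ ^ 2 * l / n) := by
    rw [norm_mul, norm_mul, hnn]
    calc _ ≤ n⁻¹ * (2 * ρ ^ 2) * (l * 1 / n) := by
          gcongr; exact hxx.trans (by gcongr; exact ht.trans hK)
      _ = _ := by ring
  rw [h0]
  refine (norm_add_le _ _).trans ?_
  have := norm_add₃_le (a := t * (a - a₀ + t * b₀) * x) (b := t * (a₀ - t * b₀) * (x - x₀))
    (c := (n : ℂ)⁻¹ * (b - b₀) * x)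
  linarith

include hB hz in
theorem norm_pairTerm_sub_le [Nonempty ι] (hij : i ≠ j) (hBij : B i j = 0) {K : ℝ} (hK : K ≤ 1)
    (ht : |t| ≤ K) :
    ‖pairTerm (B + t • Matrix.symmSingle ℝ i j) z i j
      - (t * (resolventMatrix B z j i * conj (semicircleDefect B z))
        + ((Fintype.card ι : ℂ)⁻¹ - t ^ 2)
          * ((resolventMatrix B z * Matrix.symmSingle ℂ i j * resolventMatrix B z) j i
            * conj (semicircleDefect B z)))‖
      ≤ t ^ 2 * (4 * z.im⁻¹ ^ 3 * defectBound z.im⁻¹ ‖z‖ * K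
          + (z.im⁻¹ + 2 * z.im⁻¹ ^ 2) * defectLip z.im⁻¹ ‖z‖ / Fintype.card ι)
        + (Fintype.card ι : ℝ)⁻¹ * (K * (8 * z.im⁻¹ ^ 3 * defectBound z.im⁻¹ ‖z‖)
          + 2 * z.im⁻¹ ^ 2 * defectLip z.im⁻¹ ‖z‖ / Fintype.card ι) := by
  have hM := isHermitian_add_smul_symmSingle hB i j t
  have hMij : (B + t • Matrix.symmSingle ℝ i j) i j = t := by
    simp [Matrix.symmSingle, hBij, hij]
  have h2 := norm_resolventMatrix_second_order_le hB hz i j t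
  have h1 := norm_resolventMatrix_add_smul_sub_le hB hz i j t
  have hR := norm_resolventMatrix_le hM hz
  have hS := norm_resolventMatrix_le hB hz
  have hQ := norm_semicircleDefect_le hM hz
  have hQ' := norm_semicircleDefect_add_smul_sub_le hB hz i j t
  have hn : (1 : ℝ) ≤ Fintype.card ι := by exact_mod_cast Fintype.card_pos
  rw [pairTerm, hMij]
  set R := resolventMatrix (B + t • Matrix.symmSingle ℝ i j) z
  set S := resolventMatrix B z
  have hρ : 0 ≤ z.im⁻¹ := by positivity
  have hl : 0 ≤ defectLip z.im⁻¹ ‖z‖ := by unfold defectLip; positivity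
  have hbb : R * Matrix.symmSingle ℂ i j * R - S * Matrix.symmSingle ℂ i j * S
      = (R - S) * Matrix.symmSingle ℂ i j * R + S * Matrix.symmSingle ℂ i j * (R - S) := by
    simp only [Matrix.sub_mul, Matrix.mul_sub]; abel
  refine norm_pair_expansion_le (n := Fintype.card ι) hn hK ht hρ hl ?_ ?_ ?_ ?_ ?_ ?_
  · exact ((R - S + (t : ℂ) • (S * Matrix.symmSingle ℂ i j * S)).norm_apply_le_l2_opNorm
      j i).trans h2
  · simpa using hQ
  · exact (S.norm_apply_le_l2_opNorm j i).trans hS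
  · refine (Matrix.norm_apply_le_l2_opNorm _ j i).trans
      ((norm_mul_symmSingle_mul_le i j hS hS).trans (le_of_eq (by ring)))
  · rw [← Matrix.sub_apply, hbb]
    refine (Matrix.norm_apply_le_l2_opNorm _ j i).trans ((norm_add_le _ _).trans ?_)
    have e1 := norm_mul_symmSingle_mul_le i j h1 hR
    have e2 := norm_mul_symmSingle_mul_le i j hS h1
    calc _ ≤ _ := add_le_add e1 e2
      _ = _ := by ring
  · rw [← map_sub, RCLike.norm_conj]
    exact hQ'

include hB hz in
/-- Averaging `pairTerm` over a centred two-valued entry of variance `1 / n`. -/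
theorem norm_average_pairTerm_le [Nonempty ι] (hij : i ≠ j) (hBij : B i j = 0) {K p : ℝ}
    (hK : K ≤ 1) (hK0 : 0 ≤ K) (hp : 0 ≤ p) (hp1 : p ≤ 1)
    (hvar : p * (1 - p) * K ^ 2 = (Fintype.card ι : ℝ)⁻¹) :
    ‖(p : ℂ) * pairTerm (B + ((1 - p) * K) • Matrix.symmSingle ℝ i j) z i j
      + (1 - p) * pairTerm (B + (-p * K) • Matrix.symmSingle ℝ i j) z i j‖
      ≤ (Fintype.card ι : ℝ)⁻¹ * (pairConst z.im⁻¹ ‖z‖ * (K + (Fintype.card ι : ℝ)⁻¹)) := by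
  have ht1 : |(1 - p) * K| ≤ K := by
    rw [abs_of_nonneg (mul_nonneg (by linarith) hK0)]
    exact mul_le_of_le_one_left hK0 (by linarith)
  have ht2 : |-p * K| ≤ K := by
    rw [neg_mul, abs_neg, abs_of_nonneg (mul_nonneg hp hK0)]
    exact mul_le_of_le_one_left hK0 hp1
  have h1 := norm_pairTerm_sub_le hB hz i j _ hij hBij hK ht1
  have h2 := norm_pairTerm_sub_le hB hz i j _ hij hBij hK ht2
  have hβ : 0 ≤ defectBound z.im⁻¹ ‖z‖ := by unfold defectBound; positivity
  have hl : 0 ≤ defectLip z.im⁻¹ ‖z‖ := by unfold defectLip; positivity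
  set P1 := pairTerm (B + ((1 - p) * K) • Matrix.symmSingle ℝ i j) z i j
  set P2 := pairTerm (B + (-p * K) • Matrix.symmSingle ℝ i j) z i j
  set A := resolventMatrix B z j i * conj (semicircleDefect B z)
  set D := (resolventMatrix B z * Matrix.symmSingle ℂ i j * resolventMatrix B z) j i
            * conj (semicircleDefect B z)
  set n : ℝ := (Fintype.card ι : ℝ) with hn
  have hn0 : 0 < n := by rw [hn]; exact_mod_cast Fintype.card_pos
  have hnc : (Fintype.card ι : ℂ)⁻¹ = ((n⁻¹ : ℝ) : ℂ) := by simp [hn]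
  -- Writing `1 / n` as the variance makes the cancellation below a polynomial identity in `p` and
  -- `K`.
  rw [hnc, ← hvar] at h1 h2
  set C1 := 4 * z.im⁻¹ ^ 3 * defectBound z.im⁻¹ ‖z‖ * K
          + (z.im⁻¹ + 2 * z.im⁻¹ ^ 2) * defectLip z.im⁻¹ ‖z‖ / n
  set C2 := K * (8 * z.im⁻¹ ^ 3 * defectBound z.im⁻¹ ‖z‖)
          + 2 * z.im⁻¹ ^ 2 * defectLip z.im⁻¹ ‖z‖ / n
  set F := fun t : ℝ => (t : ℂ) * A + (((p * (1 - p) * K ^ 2 : ℝ) : ℂ) - t ^ 2) * D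
  -- The leading part `F` averages to zero: `t` has mean zero and `t ^ 2` has mean `p (1 - p) K²`.
  have hsum : (p : ℂ) * P1 + (1 - p) * P2
      = (p : ℂ) * (P1 - F ((1 - p) * K)) + (1 - p) * (P2 - F (-p * K)) := by
    simp only [F]; push_cast; ring
  have hp1c : ‖(1 - p : ℂ)‖ = 1 - p := by
    rw [← Complex.ofReal_one, ← Complex.ofReal_sub, Complex.norm_real, Real.norm_eq_abs,
      abs_of_nonneg (by linarith)]
  have hpc : ‖(p : ℂ)‖ = p := by rw [Complex.norm_real, Real.norm_eq_abs, abs_of_nonneg hp]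
  rw [hsum]
  refine (norm_add_le _ _).trans ?_
  rw [norm_mul, norm_mul, hp1c, hpc]
  have hρ : 0 < z.im⁻¹ := by positivity
  have hC : C1 + C2 ≤ pairConst z.im⁻¹ ‖z‖ * (K + n⁻¹) := by
    simp only [C1, C2, pairConst]
    have e1 : 0 ≤ (z.im⁻¹ + 4 * z.im⁻¹ ^ 2) * defectLip z.im⁻¹ ‖z‖ * K := by positivity
    have e2 : 0 ≤ 12 * z.im⁻¹ ^ 3 * defectBound z.im⁻¹ ‖z‖ * n⁻¹ := by positivity
    simp only [div_eq_mul_inv] at *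
    linarith
  have hp1' : 0 ≤ 1 - p := by linarith
  calc _ ≤ p * (((1 - p) * K) ^ 2 * C1 + (p * (1 - p) * K ^ 2) * C2)
        + (1 - p) * ((-p * K) ^ 2 * C1 + (p * (1 - p) * K ^ 2) * C2) :=
        add_le_add (mul_le_mul_of_nonneg_left h1 hp) (mul_le_mul_of_nonneg_left h2 hp1')
    _ = (p * (1 - p) * K ^ 2) * (C1 + C2) := by ring
    _ = n⁻¹ * (C1 + C2) := by rw [hvar]
    _ ≤ _ := by gcongr

/-- Summing `pairTerm` over all pairs of distinct indices gives `n |Q|²` up to a bounded error. -/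
theorem norm_sum_pairTerm_sub_le [Nonempty ι] {M : Matrix ι ι ℝ} (hM : M.IsHermitian)
    {z : ℂ} (hz : 0 < z.im) (hdiag : ∀ i, M i i = 0) :
    ‖∑ i, ∑ j, (if i = j then 0 else pairTerm M z i j)
        - (Fintype.card ι : ℂ) * ((‖semicircleDefect M z‖ ^ 2 : ℝ) : ℂ)‖
      ≤ 3 * z.im⁻¹ ^ 2 * defectBound z.im⁻¹ ‖z‖ := by
  have hR := norm_resolventMatrix_le hM hz
  have hQ := norm_semicircleDefect_le hM hz
  have hmul := mul_resolventMatrix hM hz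
  set n : ℂ := (Fintype.card ι : ℂ) with hn
  have hn0 : n ≠ 0 := by rw [hn]; exact_mod_cast Fintype.card_ne_zero
  set R := resolventMatrix M z
  have hm : R.trace = n * stieltjes M z := by
    rw [stieltjes, ← hn, mul_div_cancel₀ _ hn0]
  -- Trace of `M R = 1 + z R`. Together with `n⁻¹ (tr R)² = n m²` this produces `n` times the
  -- defect.
  have htr : ∑ i, ∑ j, (M i j : ℂ) * R j i = n + z * R.trace := by
    have h1 : M.map Complex.ofReal * R = 1 + z • R := by
      rw [Matrix.sub_mul, Matrix.smul_mul, one_mul, sub_eq_iff_eq_add] at hmul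
      exact hmul
    have := congrArg Matrix.trace h1
    rw [Matrix.trace_add, Matrix.trace_smul, Matrix.trace_one, smul_eq_mul] at this
    rw [← this]
    simp [Matrix.trace, Matrix.mul_apply]
  have htt : ∑ i, ∑ j, R j j * R i i = R.trace ^ 2 := by
    rw [sq, Matrix.trace, Finset.sum_mul_sum]
    refine Finset.sum_congr rfl fun i _ => Finset.sum_congr rfl fun j _ => ?_
    simp [mul_comm]
  -- Extends the sum to `i = j`: there the entry of `M` vanishes and the two remaining terms
  -- coincide, hence the correction `2 R i i ^ 2`.
  have hterm : ∀ i j, (if i = j then 0 else pairTerm M z i j)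
      = ((M i j : ℂ) * R j i + n⁻¹ * (R j j * R i i) + n⁻¹ * (R j i ^ 2)
        - (if i = j then n⁻¹ * (2 * R i i ^ 2) else 0)) * conj (semicircleDefect M z) := by
    intro i j
    by_cases h : i = j
    · subst h; simp [hdiag]; ring_nf; simp
    · simp only [h, if_false, pairTerm, sub_zero, Matrix.mul_symmSingle_mul_apply]
      change ((M i j : ℂ) * R j i + n⁻¹ * (R j i * R j i + R j j * R i i)) * _ = _
      ring
  have hsum : ∑ i, ∑ j, (if i = j then 0 else pairTerm M z i j)
      - n * ((‖semicircleDefect M z‖ ^ 2 : ℝ) : ℂ)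
      = (n⁻¹ * (∑ j, ∑ i, R i j ^ 2 - 2 * ∑ i, R i i ^ 2)) * conj (semicircleDefect M z) := by
    have hq : ((‖semicircleDefect M z‖ ^ 2 : ℝ) : ℂ)
        = semicircleDefect M z * conj (semicircleDefect M z) := by
      rw [Complex.mul_conj, Complex.normSq_eq_norm_sq]
    simp_rw [hterm, ← Finset.sum_mul, Finset.sum_sub_distrib, Finset.sum_add_distrib,
      ← Finset.mul_sum, htr, htt, hm]
    rw [hq]
    simp only [Finset.sum_ite_eq, Finset.mem_univ, if_true, ← Finset.mul_sum, semicircleDefect]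
    field_simp
    ring
  rw [hsum, norm_mul, norm_mul, RCLike.norm_conj]
  have hnr : ‖n⁻¹‖ = (Fintype.card ι : ℝ)⁻¹ := by rw [norm_inv, hn, Complex.norm_natCast]
  have hnr0 : (0 : ℝ) < Fintype.card ι := by exact_mod_cast Fintype.card_pos
  have hb1 : ‖∑ j, ∑ i, R i j ^ 2‖ ≤ Fintype.card ι * z.im⁻¹ ^ 2 := by
    refine (norm_sum_le _ _).trans ?_
    refine (Finset.sum_le_sum (g := fun _ => z.im⁻¹ ^ 2) fun j _ => ?_).trans (by simp)
    refine (norm_sum_le _ _).trans ?_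
    simp_rw [norm_pow]
    exact (R.sum_norm_sq_col_le j).trans (by gcongr)
  have hb2 : ‖∑ i, R i i ^ 2‖ ≤ Fintype.card ι * z.im⁻¹ ^ 2 := by
    refine (norm_sum_le _ _).trans ?_
    refine (Finset.sum_le_sum (g := fun _ => z.im⁻¹ ^ 2) fun j _ => ?_).trans (by simp)
    rw [norm_pow]
    gcongr
    exact (R.norm_apply_le_l2_opNorm j j).trans hR
  rw [hnr]
  have hb3 : ‖∑ j, ∑ i, R i j ^ 2 - 2 * ∑ i, R i i ^ 2‖
      ≤ Fintype.card ι * (3 * z.im⁻¹ ^ 2) := by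
    refine (norm_sub_le _ _).trans ?_
    rw [norm_mul, Complex.norm_ofNat]
    linarith
  calc _ ≤ (Fintype.card ι : ℝ)⁻¹ * (Fintype.card ι * (3 * z.im⁻¹ ^ 2))
        * defectBound z.im⁻¹ ‖z‖ := by gcongr
    _ = _ := by field_simp

end

/-! ### The binomial random graph and resampling of one edge. -/

section

open SimpleGraph

instance measurableSingletonClass_simpleGraph {V : Type*} [Countable V] :
    MeasurableSingletonClass (SimpleGraph V) where
  measurableSet_singleton G := by
    have h : ({G} : Set (SimpleGraph V))
        = ⋂ u, ⋂ v, {H : SimpleGraph V | H.Adj u v ↔ G.Adj u v} := by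
      ext H
      simp [SimpleGraph.ext_iff, funext_iff]
    rw [h]
    refine MeasurableSet.iInter fun u => MeasurableSet.iInter fun v => ?_
    have hm : Measurable fun H : SimpleGraph V => H.Adj u v := by fun_prop
    by_cases hG : G.Adj u v
    · simpa [hG] using measurableSet_setOfPred.2 hm
    · simpa [hG] using measurableSet_setOfPred.2 hm.not

variable {V : Type*} [Fintype V]

theorem binomialRandom_real_singleton (p : unitInterval) (G : SimpleGraph V) :
    (binomialRandom V p).real {G} = (p : ℝ) ^ G.edgeSet.ncard
      * (1 - (p : ℝ)) ^ ((Fintype.card V).choose 2 - G.edgeSet.ncard) := by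
  rw [measureReal_def, binomialRandom_singleton, Nat.card_eq_fintype_card]
  simp

omit [Fintype V] in
theorem edgeSet_sup_edge {G : SimpleGraph V} {i j : V} (hij : i ≠ j) :
    (G ⊔ edge i j).edgeSet = insert s(i, j) G.edgeSet := by
  rw [edgeSet_sup, edgeSet_edge_of_ne hij, Set.union_comm, Set.insert_eq]

/-- Conditioning on all pairs but one: the remaining pair is an edge with probability `p`. -/
theorem integral_binomialRandom_eq_average {E : Type*} [NormedAddCommGroup E] [NormedSpace ℝ E]
    [CompleteSpace E] (p : unitInterval) {i j : V} (hij : i ≠ j) (f : SimpleGraph V → E) :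
    ∫ G, f G ∂(binomialRandom V p)
      = ∫ G, ((p : ℝ) • f (G ⊔ edge i j) + (1 - (p : ℝ)) • f (G.deleteEdges {s(i, j)}))
          ∂(binomialRandom V p) := by
  classical
  -- Each graph without the edge is matched with the graph obtained by adding it. The averaged
  -- integrand agrees on both, and their weights are in ratio `(1 - p) : p`.
  have key : ∀ F : SimpleGraph V → E, ∑ G, F G
      = ∑ G with ¬ G.Adj i j, (F G + F (G ⊔ edge i j)) := by
    intro F
    rw [← Finset.sum_filter_not_add_sum_filter Finset.univ (fun G : SimpleGraph V => G.Adj i j),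
      Finset.sum_add_distrib]
    congr 1
    refine Finset.sum_nbij' (fun G => G.deleteEdges {s(i, j)}) (fun G => G ⊔ edge i j) ?_ ?_ ?_ ?_ ?_
    · intro G _; simp
    · intro G _; simp [edge_adj, hij]
    · intro G hG
      simp only [Finset.mem_filter, Finset.mem_univ, true_and] at hG
      ext u v
      simp only [sup_adj, deleteEdges_adj, edge_adj, Set.mem_singleton_iff, Sym2.eq_iff]
      constructor
      · rintro (h | ⟨⟨rfl, rfl⟩ | ⟨rfl, rfl⟩, -⟩)
        · exact h.1
        · exact hG
        · exact hG.symm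
      · intro h
        by_cases hc : u = i ∧ v = j ∨ u = j ∧ v = i
        · exact Or.inr ⟨hc, h.ne⟩
        · exact Or.inl ⟨h, hc⟩
    · intro G hG
      simp only [Finset.mem_filter, Finset.mem_univ, true_and] at hG
      ext u v
      simp only [sup_adj, deleteEdges_adj, edge_adj, Set.mem_singleton_iff, Sym2.eq_iff]
      constructor
      · rintro ⟨h | h, h2⟩
        · exact h
        · exact absurd h.1 h2
      · intro h
        refine ⟨Or.inl h, ?_⟩
        rintro (⟨rfl, rfl⟩ | ⟨rfl, rfl⟩)
        · exact hG h
        · exact hG h.symm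
    · intro G hG
      simp only [Finset.mem_filter, Finset.mem_univ, true_and] at hG
      congr 1
      ext u v
      simp only [sup_adj, deleteEdges_adj, edge_adj, Set.mem_singleton_iff, Sym2.eq_iff]
      constructor
      · intro h
        by_cases hc : u = i ∧ v = j ∨ u = j ∧ v = i
        · exact Or.inr ⟨hc, h.ne⟩
        · exact Or.inl ⟨h, hc⟩
      · rintro (h | ⟨⟨rfl, rfl⟩ | ⟨rfl, rfl⟩, -⟩)
        · exact h.1
        · exact hG
        · exact hG.symm
  rw [integral_fintype .of_finite, integral_fintype .of_finite, key, key]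
  refine Finset.sum_congr rfl fun G hG => ?_
  simp only [Finset.mem_filter, Finset.mem_univ, true_and] at hG
  have h1 : G.deleteEdges {s(i, j)} = G := by
    rw [deleteEdges_eq_self]; simpa using hG
  have h2 : (G ⊔ edge i j).deleteEdges {s(i, j)} = G := by
    ext u v
    simp only [sup_adj, deleteEdges_adj, edge_adj, Set.mem_singleton_iff, Sym2.eq_iff]
    constructor
    · rintro ⟨h | h, h2⟩
      · exact h
      · exact absurd h.1 h2
    · intro h
      refine ⟨Or.inl h, ?_⟩
      rintro (⟨rfl, rfl⟩ | ⟨rfl, rfl⟩)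
      · exact hG h
      · exact hG h.symm
  have h3 : G ⊔ edge i j ⊔ edge i j = G ⊔ edge i j := by rw [sup_assoc, sup_idem]
  have hcard : (G ⊔ edge i j).edgeSet.ncard = G.edgeSet.ncard + 1 := by
    rw [edgeSet_sup_edge hij, Set.ncard_insert_of_notMem (by simpa using hG)]
  -- Keeps the truncated subtractions in the exponents exact.
  have hle : G.edgeSet.ncard + 1 ≤ (Fintype.card V).choose 2 := by
    rw [← hcard, ← coe_edgeFinset, Set.ncard_coe_finset]
    exact card_edgeFinset_le_card_choose_two
  obtain ⟨d, hd⟩ := Nat.exists_eq_add_of_le hle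
  simp only [binomialRandom_real_singleton, hcard, h1, h2, h3, hd]
  rw [show G.edgeSet.ncard + 1 + d - G.edgeSet.ncard = d + 1 by omega,
    show G.edgeSet.ncard + 1 + d - (G.edgeSet.ncard + 1) = d by omega]
  module

end

/-! ### The centred adjacency matrix and the mean square of its defect. -/

/-- The normalization `1 / (√n σ)`. -/
noncomputable def scaleFactor (n : ℕ) (p : unitInterval) : ℝ :=
  1 / (Real.sqrt n * bernoulliSigma p)

theorem scaleFactor_nonneg (n : ℕ) (p : unitInterval) : 0 ≤ scaleFactor n p := by
  unfold scaleFactor bernoulliSigma; positivity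

theorem scaleFactor_sq (n : ℕ) (p : unitInterval) :
    scaleFactor n p ^ 2 = (n * ((p : ℝ) * (1 - p)))⁻¹ := by
  have h : (0 : ℝ) ≤ p * (1 - p) := mul_nonneg p.2.1 (by linarith [p.2.2])
  rw [scaleFactor, bernoulliSigma, one_div, inv_pow, mul_pow, Real.sq_sqrt (by positivity),
    Real.sq_sqrt h]

open Classical in
/-- The centred and normalized adjacency matrix. -/
noncomputable def centredAdjMatrix {n : ℕ} (p : unitInterval) (G : SimpleGraph (Fin n)) :
    Matrix (Fin n) (Fin n) ℝ :=
  Matrix.of fun i j => if i = j then 0 else scaleFactor n p * ((if G.Adj i j then 1 else 0) - p)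

section

variable {n : ℕ} (p : unitInterval)

theorem centredAdjMatrix_isHermitian (G : SimpleGraph (Fin n)) :
    (centredAdjMatrix p G).IsHermitian := by
  ext i j
  by_cases hij : i = j
  · subst hij
    simp [centredAdjMatrix]
  · by_cases h : G.Adj i j
    · simp [centredAdjMatrix, Matrix.conjTranspose_apply, hij, Ne.symm hij, h, h.symm]
    · have h' : ¬ G.Adj j i := fun h' => h h'.symm
      simp [centredAdjMatrix, Matrix.conjTranspose_apply, hij, Ne.symm hij, h, h']

theorem scaledAdjMatrix_sub_centredAdjMatrix (G : SimpleGraph (Fin n)) (i j : Fin n) :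
    scaledAdjMatrix p G i j - centredAdjMatrix p G i j
      = if i = j then 0 else scaleFactor n p * p := by
  by_cases h : i = j
  · subst h
    simp [scaledAdjMatrix, centredAdjMatrix]
  · simp only [scaledAdjMatrix, centredAdjMatrix, Matrix.smul_apply, SimpleGraph.adjMatrix_apply,
      Matrix.of_apply, h, if_false, scaleFactor, smul_eq_mul]
    ring

/-- `B` is the centred matrix with the entries of this pair zeroed, so both outcomes of the edge
perturb one common matrix. -/
theorem exists_centredAdjMatrix_eq_add (G : SimpleGraph (Fin n)) {i j : Fin n} (hij : i ≠ j) :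
    ∃ B : Matrix (Fin n) (Fin n) ℝ, B.IsHermitian ∧ B i j = 0 ∧
      centredAdjMatrix p (G ⊔ SimpleGraph.edge i j)
        = B + ((1 - (p : ℝ)) * scaleFactor n p) • Matrix.symmSingle ℝ i j ∧
      centredAdjMatrix p (G.deleteEdges {s(i, j)})
        = B + (-(p : ℝ) * scaleFactor n p) • Matrix.symmSingle ℝ i j := by
  classical
  refine ⟨centredAdjMatrix p (G.deleteEdges {s(i, j)})
    + ((p : ℝ) * scaleFactor n p) • Matrix.symmSingle ℝ i j,
    isHermitian_add_smul_symmSingle (centredAdjMatrix_isHermitian p _) i j _, ?_, ?_, ?_⟩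
  · simp [centredAdjMatrix, hij, Matrix.symmSingle]
    ring
  · ext u v
    simp only [centredAdjMatrix, Matrix.of_apply, Matrix.add_apply, Matrix.smul_apply,
      Matrix.symmSingle, Matrix.single_apply, SimpleGraph.sup_adj, SimpleGraph.edge_adj,
      SimpleGraph.deleteEdges_adj, Set.mem_singleton_iff, Sym2.eq_iff, smul_eq_mul]
    by_cases huv : u = v
    · subst huv
      have h1 : ¬ (i = u ∧ j = u) := fun h => hij (h.1.trans h.2.symm)
      have h2 : ¬ (j = u ∧ i = u) := fun h => hij (h.2.trans h.1.symm)
      simp [h1, h2]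
    · by_cases h1 : u = i ∧ v = j
      · obtain ⟨rfl, rfl⟩ := h1
        simp [huv]
        ring
      · by_cases h2 : u = j ∧ v = i
        · obtain ⟨rfl, rfl⟩ := h2
          simp [huv]
          ring
        · have h1' : ¬ (i = u ∧ j = v) := fun h => h1 ⟨h.1.symm, h.2.symm⟩
          have h2' : ¬ (j = u ∧ i = v) := fun h => h2 ⟨h.1.symm, h.2.symm⟩
          simp [huv, h1, h2, h1', h2']
  · rw [add_assoc, ← add_smul]
    simp

/-- The mean square of the semicircle defect of the centred adjacency matrix is small. -/
theorem integral_norm_semicircleDefect_sq_le [NeZero n] (hp : 0 < (p : ℝ)) (hp1 : (p : ℝ) < 1)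
    (hK : scaleFactor n p ≤ 1) {z : ℂ} (hz : 0 < z.im) :
    ∫ G, ‖semicircleDefect (centredAdjMatrix p G) z‖ ^ 2 ∂(SimpleGraph.binomialRandom (Fin n) p)
      ≤ pairConst z.im⁻¹ ‖z‖ * (scaleFactor n p + (n : ℝ)⁻¹)
        + 3 * z.im⁻¹ ^ 2 * defectBound z.im⁻¹ ‖z‖ * (n : ℝ)⁻¹ := by
  set P := SimpleGraph.binomialRandom (Fin n) p
  have hn0 : (0 : ℝ) < n := by exact_mod_cast Nat.pos_of_ne_zero (NeZero.ne n)
  have hvar : (p : ℝ) * (1 - p) * scaleFactor n p ^ 2 = (Fintype.card (Fin n) : ℝ)⁻¹ := by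
    have : (1 - (p : ℝ)) ≠ 0 := by linarith
    rw [scaleFactor_sq, Fintype.card_fin]
    field_simp
  set C := pairConst z.im⁻¹ ‖z‖ * (scaleFactor n p + (n : ℝ)⁻¹) with hC
  have hC0 : 0 ≤ C := by
    have := scaleFactor_nonneg n p
    rw [hC]
    unfold pairConst defectBound defectLip
    positivity
  have hpair : ∀ i j : Fin n, i ≠ j →
      ‖∫ G, pairTerm (centredAdjMatrix p G) z i j ∂P‖ ≤ (n : ℝ)⁻¹ * C := by
    intro i j hij
    rw [integral_binomialRandom_eq_average p hij]
    refine (norm_integral_le_of_norm_le_const (C := (n : ℝ)⁻¹ * C)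
      (.of_forall fun G => ?_)).trans (by simp)
    obtain ⟨B, hB, hBij, h1, h2⟩ := exists_centredAdjMatrix_eq_add p G hij
    have := norm_average_pairTerm_le hB hz i j hij hBij hK (scaleFactor_nonneg n p) hp.le hp1.le
      hvar
    rw [h1, h2]
    simpa [Fintype.card_fin, Complex.real_smul] using this
  -- At most `n²` pairs, each contributing at most `n⁻¹ C`.
  have hS : ‖∫ G, ∑ i, ∑ j, (if i = j then 0 else pairTerm (centredAdjMatrix p G) z i j) ∂P‖
      ≤ n * C := by
    rw [integral_finsetSum _ fun _ _ => .of_finite]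
    simp_rw [integral_finsetSum _ fun _ _ => (Integrable.of_finite (μ := P))]
    refine (norm_sum_le _ _).trans ?_
    refine (Finset.sum_le_sum (g := fun _ => C) fun i _ => ?_).trans (by simp)
    refine (norm_sum_le _ _).trans ?_
    refine (Finset.sum_le_sum (g := fun _ => (n : ℝ)⁻¹ * C) fun j _ => ?_).trans
      (by simp [mul_inv_cancel_left₀ hn0.ne'])
    by_cases hij : i = j
    · simp [hij]; positivity
    · simpa [hij] using hpair i j hij
  have hdiff : ‖∫ G, (∑ i, ∑ j, (if i = j then 0 else pairTerm (centredAdjMatrix p G) z i j)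
      - (n : ℂ) * ((‖semicircleDefect (centredAdjMatrix p G) z‖ ^ 2 : ℝ) : ℂ)) ∂P‖
      ≤ 3 * z.im⁻¹ ^ 2 * defectBound z.im⁻¹ ‖z‖ := by
    refine (norm_integral_le_of_norm_le_const (.of_forall fun G => ?_)).trans
      (le_of_eq (by simp [P]; rfl))
    have := norm_sum_pairTerm_sub_le (centredAdjMatrix_isHermitian p G) hz
      (fun i => by simp [centredAdjMatrix])
    simpa [Fintype.card_fin] using this
  rw [integral_sub .of_finite .of_finite, integral_const_mul, integral_complex_ofReal] at hdiff
  set I := ∫ G, ‖semicircleDefect (centredAdjMatrix p G) z‖ ^ 2 ∂P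
  set S := ∫ G, ∑ i, ∑ j, (if i = j then 0 else pairTerm (centredAdjMatrix p G) z i j) ∂P
  have hI : (n : ℝ) * I ≤ n * C + 3 * z.im⁻¹ ^ 2 * defectBound z.im⁻¹ ‖z‖ := by
    have h1 : ‖(n : ℂ) * (I : ℂ)‖ = |n * I| := by
      rw [← Complex.ofReal_natCast, ← Complex.ofReal_mul, Complex.norm_real, Real.norm_eq_abs]
    calc (n : ℝ) * I ≤ ‖(n : ℂ) * (I : ℂ)‖ := by rw [h1]; exact le_abs_self _
      _ = ‖S - (S - (n : ℂ) * (I : ℂ))‖ := by rw [sub_sub_cancel]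
      _ ≤ _ := (norm_sub_le _ _).trans (add_le_add hS hdiff)
  calc I = (n : ℝ)⁻¹ * (n * I) := by field_simp
    _ ≤ (n : ℝ)⁻¹ * (n * C + 3 * z.im⁻¹ ^ 2 * defectBound z.im⁻¹ ‖z‖) := by gcongr
    _ = _ := by field_simp

end

/-! ### Empirical spectral measures and stability of the semicircle equation. -/

/-- The empirical spectral measure of a symmetric matrix. -/
noncomputable def esdMeasure {n : ℕ} {M : Matrix (Fin n) (Fin n) ℝ} (hM : M.IsHermitian) :
    Measure ℝ :=
  (n : ENNReal)⁻¹ • ∑ j, Measure.dirac (hM.eigenvalues j)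

section

variable {n : ℕ} {M : Matrix (Fin n) (Fin n) ℝ} (hM : M.IsHermitian)

instance isProbabilityMeasure_esdMeasure [NeZero n] : IsProbabilityMeasure (esdMeasure hM) := by
  refine ⟨?_⟩
  simp only [esdMeasure, Measure.smul_apply, Measure.finsetSum_apply, measure_univ, smul_eq_mul,
    Finset.sum_const, Finset.card_univ, Fintype.card_fin, nsmul_eq_mul, mul_one]
  exact ENNReal.inv_mul_cancel (by exact_mod_cast NeZero.ne n) (ENNReal.natCast_ne_top n)

theorem esdMeasure_real_Iic (x : ℝ) : (esdMeasure hM).real (Set.Iic x) = esd hM x := by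
  have h : (∑ j, Measure.dirac (hM.eigenvalues j)) (Set.Iic x)
      = ((Finset.univ.filter fun j : Fin n => hM.eigenvalues j ≤ x).card : ENNReal) := by
    simp [Measure.finsetSum_apply, Measure.dirac_apply' _ measurableSet_Iic, Set.indicator_apply]
  rw [measureReal_def, esdMeasure, Measure.smul_apply, h, smul_eq_mul, ENNReal.toReal_mul, esd]
  simp [div_eq_inv_mul]

theorem integral_esdMeasure {z : ℂ} (hz : 0 < z.im) :
    ∫ t : ℝ, ((t : ℂ) - z)⁻¹ ∂(esdMeasure hM) = stieltjes M z := by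
  rw [esdMeasure, integral_smul_measure, integral_finsetSum_measure, stieltjes,
    trace_resolventMatrix hM hz]
  · simp [div_eq_inv_mul]
  · exact fun j _ => integrable_dirac (by simp)

theorem esd_nonneg (x : ℝ) : 0 ≤ esd hM x := by unfold esd; positivity

theorem esd_le_one (x : ℝ) : esd hM x ≤ 1 := by
  unfold esd
  refine div_le_one_of_le₀ ?_ (by positivity)
  exact_mod_cast (Finset.card_filter_le _ _).trans (by simp)

/-- Stability of the equation `m² + z m + 1 = 0` in the upper half-plane. -/
theorem norm_sub_le_of_defect {z s m : ℂ} (hz : 0 < z.im) (hs : s ^ 2 + z * s + 1 = 0)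
    (hs1 : ‖s‖ < 1) (hm : 0 ≤ m.im) : ‖m - s‖ ≤ z.im⁻¹ * ‖m ^ 2 + z * m + 1‖ := by
  have h0 : s ≠ 0 := by rintro rfl; simp at hs
  have hsim : 0 ≤ s.im := by
    rw [← integral_semicircleLaw_resolvent hz hs hs1]
    have hi : Integrable (fun t : ℝ => ((t : ℂ) - z)⁻¹) semicircleLaw := by
      refine Integrable.of_bound (C := z.im⁻¹) ?_ (.of_forall fun t => norm_ofReal_sub_inv_le hz t)
      exact (Continuous.inv₀ (by fun_prop) (ofReal_sub_ne_zero hz)).aestronglyMeasurable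
    have := integral_im (𝕜 := ℂ) hi
    simp only [RCLike.im_to_complex] at this
    rw [← this]
    refine integral_nonneg fun t => ?_
    rw [Pi.zero_apply, Complex.inv_im]
    simp only [Complex.sub_im, Complex.ofReal_im, zero_sub, neg_neg]
    exact div_nonneg hz.le (Complex.normSq_nonneg _)
  have hfac : m ^ 2 + z * m + 1 = (m - s) * (m + z + s) := by linear_combination hs
  -- Both `m` and `s` have nonnegative imaginary part, so `Im (m + z + s)` is at least `Im z`.
  have hlow : z.im ≤ ‖m + z + s‖ := by
    refine le_trans ?_ (Complex.abs_im_le_norm _)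
    refine le_trans ?_ (le_abs_self _)
    simp only [Complex.add_im]
    linarith
  rw [hfac, norm_mul, ← div_eq_inv_mul, le_div_iff₀ hz]
  gcongr

end

/-! ### Convergence in probability as convergence along a filter, and the limit. -/

/-- The filter of sets of graphs, of any positive number of vertices, that the binomial random
graph belongs to with probability tending to one. -/
def binomialRandomFilter (p : ℕ → unitInterval) : Filter (Σ n : ℕ, SimpleGraph (Fin (n + 1))) where
  sets := {S | Tendsto (fun n : ℕ => (SimpleGraph.binomialRandom (Fin (n + 1)) (p (n + 1))).real
    {G | (⟨n, G⟩ : Σ n : ℕ, SimpleGraph (Fin (n + 1))) ∉ S}) atTop (𝓝 0)}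
  univ_sets := by simp
  sets_of_superset {S T} hS hST := by
    refine squeeze_zero (fun _ => measureReal_nonneg) (fun n => ?_) hS
    exact measureReal_mono fun G hG h => hG (hST h)
  inter_sets {S T} hS hT := by
    refine squeeze_zero (fun _ => measureReal_nonneg) (fun n => ?_)
      (by simpa using Tendsto.add hS hT)
    refine le_trans (measureReal_mono fun G hG => ?_) (measureReal_union_le _ _)
    by_cases h : (⟨n, G⟩ : Σ n : ℕ, SimpleGraph (Fin (n + 1))) ∈ S
    · exact Or.inr fun h' => hG ⟨h, h'⟩
    · exact Or.inl h

section

variable {p : ℕ → unitInterval}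

theorem mem_binomialRandomFilter {S : Set (Σ n : ℕ, SimpleGraph (Fin (n + 1)))} :
    S ∈ binomialRandomFilter p ↔
      Tendsto (fun n : ℕ => (SimpleGraph.binomialRandom (Fin (n + 1)) (p (n + 1))).real
        {G | (⟨n, G⟩ : Σ n : ℕ, SimpleGraph (Fin (n + 1))) ∉ S}) atTop (𝓝 0) :=
  Iff.rfl

theorem tendsto_fst_binomialRandomFilter :
    Tendsto (fun a : Σ n : ℕ, SimpleGraph (Fin (n + 1)) => a.1) (binomialRandomFilter p) atTop := by
  intro S hS
  rw [mem_map, mem_binomialRandomFilter]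
  refine tendsto_const_nhds.congr' ?_
  filter_upwards [hS] with n hn
  simp [hn]

/-- Convergence to zero in mean square implies convergence to zero in probability. -/
theorem tendsto_binomialRandomFilter_of_integral_sq
    {f : ∀ n : ℕ, SimpleGraph (Fin (n + 1)) → ℝ} (hf : ∀ n G, 0 ≤ f n G)
    (h : Tendsto (fun n => ∫ G, f n G ^ 2
      ∂(SimpleGraph.binomialRandom (Fin (n + 1)) (p (n + 1)))) atTop (𝓝 0)) :
    Tendsto (fun a : Σ n : ℕ, SimpleGraph (Fin (n + 1)) => f a.1 a.2)
      (binomialRandomFilter p) (𝓝 0) := by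
  rw [Metric.tendsto_nhds]
  intro ε hε
  rw [Filter.Eventually, mem_binomialRandomFilter]
  have h2 := h.const_mul (ε ^ 2)⁻¹
  rw [mul_zero] at h2
  refine squeeze_zero (fun _ => measureReal_nonneg) (fun n => ?_) h2
  -- Chebyshev's inequality, as Markov's inequality for the square.
  have hm := mul_meas_ge_le_integral_of_nonneg
    (μ := SimpleGraph.binomialRandom (Fin (n + 1)) (p (n + 1))) (f := fun G => f n G ^ 2)
    (.of_forall fun G => sq_nonneg _) .of_finite (ε ^ 2)
  rw [← div_eq_inv_mul, le_div_iff₀ (by positivity), mul_comm]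
  refine le_trans ?_ hm
  refine mul_le_mul_of_nonneg_left (measureReal_mono fun G hG => ?_) (sq_nonneg _)
  simp only [Set.mem_ofPred_eq, not_lt, Real.dist_eq, sub_zero, abs_of_nonneg (hf n G)] at hG
  exact pow_le_pow_left₀ hε.le hG 2

end

section

variable {p : ℕ → unitInterval}
  (hp : (fun n : ℕ => 1 / (n : ℝ)) =o[atTop] fun n : ℕ => (p n : ℝ))
  (hq : (fun n : ℕ => 1 / (n : ℝ)) =o[atTop] fun n : ℕ => 1 - (p n : ℝ))

theorem eventually_pos_of_isLittleO {f : ℕ → ℝ} (hf : ∀ n, 0 ≤ f n)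
    (h : (fun n : ℕ => 1 / (n : ℝ)) =o[atTop] f) : ∀ᶠ n in atTop, 0 < f n := by
  filter_upwards [h.bound one_pos, eventually_gt_atTop 0] with n hn hn0
  refine lt_of_le_of_ne (hf n) fun h0 => ?_
  rw [← h0, norm_zero, mul_zero] at hn
  have : (0 : ℝ) < 1 / n := by positivity
  exact absurd hn (not_le.2 (by rwa [Real.norm_of_nonneg this.le]))

include hp hq in
-- Since `1 / (n p (1 - p)) = 1 / (n p) + 1 / (n (1 - p))`, the two growth hypotheses say exactly
-- what is needed.
theorem tendsto_scaleFactor : Tendsto (fun n => scaleFactor n (p n)) atTop (𝓝 0) := by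
  have h1 := hp.tendsto_div_nhds_zero
  have h2 := hq.tendsto_div_nhds_zero
  have h3 : Tendsto (fun n => scaleFactor n (p n) ^ 2) atTop (𝓝 0) := by
    have h12 := h1.add h2
    rw [add_zero] at h12
    refine h12.congr' ?_
    filter_upwards [eventually_pos_of_isLittleO (fun n => (p n).2.1) hp,
      eventually_pos_of_isLittleO (fun n => sub_nonneg.2 (p n).2.2) hq, eventually_gt_atTop 0]
      with n hn1 hn2 hn0
    rw [scaleFactor_sq]
    have : (n : ℝ) ≠ 0 := by positivity
    field_simp
    ring
  have h4 := h3.sqrt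
  rw [Real.sqrt_zero] at h4
  exact h4.congr fun n => Real.sqrt_sq (scaleFactor_nonneg n _)

include hp hq in
theorem tendsto_integral_norm_semicircleDefect_sq {z : ℂ} (hz : 0 < z.im) :
    Tendsto (fun n : ℕ => ∫ G, ‖semicircleDefect (centredAdjMatrix (p (n + 1)) G) z‖ ^ 2
      ∂(SimpleGraph.binomialRandom (Fin (n + 1)) (p (n + 1)))) atTop (𝓝 0) := by
  have hK := tendsto_scaleFactor hp hq
  have hn : Tendsto (fun n : ℕ => (n : ℝ)⁻¹) atTop (𝓝 0) := tendsto_inv_atTop_nhds_zero_nat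
  have hlim : Tendsto (fun n : ℕ => pairConst z.im⁻¹ ‖z‖ * (scaleFactor n (p n) + (n : ℝ)⁻¹)
        + 3 * z.im⁻¹ ^ 2 * defectBound z.im⁻¹ ‖z‖ * (n : ℝ)⁻¹) atTop (𝓝 0) := by
    simpa only [add_zero, mul_zero] using ((hK.add hn).const_mul (pairConst z.im⁻¹ ‖z‖)).add
      (hn.const_mul (3 * z.im⁻¹ ^ 2 * defectBound z.im⁻¹ ‖z‖))
  refine squeeze_zero' (.of_forall fun n => integral_nonneg fun G => by positivity) ?_
    (hlim.comp (tendsto_add_atTop_nat 1))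
  have hev : ∀ᶠ n in atTop, 0 < (p n : ℝ) ∧ (p n : ℝ) < 1 ∧ scaleFactor n (p n) ≤ 1 := by
    filter_upwards [eventually_pos_of_isLittleO (fun n => (p n).2.1) hp,
      eventually_pos_of_isLittleO (fun n => sub_nonneg.2 (p n).2.2) hq,
      hK.eventually (gt_mem_nhds one_pos)] with n h1 h2 h3
    exact ⟨h1, by linarith, h3.le⟩
  filter_upwards [(tendsto_add_atTop_nat 1).eventually hev] with n ⟨h1, h2, h3⟩
  exact integral_norm_semicircleDefect_sq_le (p (n + 1)) h1 h2 h3 hz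

include hp hq in
-- Two errors: centring, controlled by the scale factor, and the distance of the centred transform
-- from `s`, controlled by the defect through stability.
theorem tendsto_stieltjes_scaledAdjMatrix {z : ℂ} (hz : 0 < z.im) :
    Tendsto (fun a : Σ n : ℕ, SimpleGraph (Fin (n + 1)) =>
        stieltjes (scaledAdjMatrix (p (a.1 + 1)) a.2) z) (binomialRandomFilter p)
      (𝓝 (∫ t : ℝ, ((t : ℂ) - z)⁻¹ ∂semicircleLaw)) := by
  obtain ⟨s, hs, hs1⟩ := exists_root_norm_lt_one hz
  rw [integral_semicircleLaw_resolvent hz hs hs1, tendsto_iff_norm_sub_tendsto_zero]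
  have hQ : Tendsto (fun a : Σ n : ℕ, SimpleGraph (Fin (n + 1)) =>
      ‖semicircleDefect (centredAdjMatrix (p (a.1 + 1)) a.2) z‖) (binomialRandomFilter p) (𝓝 0) :=
    tendsto_binomialRandomFilter_of_integral_sq
      (f := fun n G => ‖semicircleDefect (centredAdjMatrix (p (n + 1)) G) z‖)
      (fun _ _ => norm_nonneg _) (tendsto_integral_norm_semicircleDefect_sq hp hq hz)
  have hK : Tendsto (fun a : Σ n : ℕ, SimpleGraph (Fin (n + 1)) =>
      scaleFactor (a.1 + 1) (p (a.1 + 1))) (binomialRandomFilter p) (𝓝 0) :=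
    (tendsto_scaleFactor hp hq).comp
      ((tendsto_add_atTop_nat 1).comp tendsto_fst_binomialRandomFilter)
  have hlim := (hK.const_mul (2 * z.im⁻¹ ^ 2)).add (hQ.const_mul z.im⁻¹)
  rw [mul_zero, mul_zero, add_zero] at hlim
  refine squeeze_zero (fun _ => norm_nonneg _) (fun a => ?_) hlim
  obtain ⟨n, G⟩ := a
  set A := scaledAdjMatrix (p (n + 1)) G
  set W := centredAdjMatrix (p (n + 1)) G
  have hA : A.IsHermitian := scaledAdjMatrix_isHermitian _ _
  have hW : W.IsHermitian := centredAdjMatrix_isHermitian _ _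
  have h1 := norm_stieltjes_sub_le_of_const hA hW hz
    (scaledAdjMatrix_sub_centredAdjMatrix (p (n + 1)) G)
  have h2 := norm_sub_le_of_defect hz hs hs1 (stieltjes_im_nonneg hW hz)
  have h3 : |scaleFactor (n + 1) (p (n + 1)) * (p (n + 1) : ℝ)|
      ≤ scaleFactor (n + 1) (p (n + 1)) := by
    rw [abs_of_nonneg (mul_nonneg (scaleFactor_nonneg _ _) (p (n + 1)).2.1)]
    exact mul_le_of_le_one_right (scaleFactor_nonneg _ _) (p (n + 1)).2.2
  calc ‖stieltjes A z - s‖ ≤ ‖stieltjes A z - stieltjes W z‖ + ‖stieltjes W z - s‖ :=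
        norm_sub_le_norm_sub_add_norm_sub _ _ _
    _ ≤ 2 * scaleFactor (n + 1) (p (n + 1)) * z.im⁻¹ ^ 2 + z.im⁻¹ * ‖semicircleDefect W z‖ :=
        add_le_add (h1.trans (by gcongr)) h2
    _ = _ := by ring

include hp hq in
theorem tendsto_esd_scaledAdjMatrix (x : ℝ) :
    Tendsto (fun a : Σ n : ℕ, SimpleGraph (Fin (n + 1)) =>
        esd (scaledAdjMatrix_isHermitian (p (a.1 + 1)) a.2) x) (binomialRandomFilter p)
      (𝓝 (semicircleCDF x)) := by
  have h := tendsto_cdf_of_tendsto_stieltjes (L := binomialRandomFilter p)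
    (μ := fun a => esdMeasure (scaledAdjMatrix_isHermitian (p (a.1 + 1)) a.2))
    (ν := semicircleLaw) (x := x) (fun z hz => by
      simp_rw [integral_esdMeasure _ hz]
      exact tendsto_stieltjes_scaledAdjMatrix hp hq hz) (semicircleLaw_singleton x)
  simp_rw [esdMeasure_real_Iic] at h
  exact h

end

/-- Convergence in probability of variables in `[0, 1]` to a constant implies convergence of the
means. -/
theorem tendsto_integral_of_tendsto_measureReal {Ω : ℕ → Type*} [∀ n, MeasurableSpace (Ω n)]
    {P : ∀ n, Measure (Ω n)} [∀ n, IsProbabilityMeasure (P n)] {X : ∀ n, Ω n → ℝ} {c : ℝ}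
    (hm : ∀ n, Measurable (X n)) (h0 : ∀ n ω, 0 ≤ X n ω) (h1 : ∀ n ω, X n ω ≤ 1) (hc0 : 0 ≤ c)
    (hc1 : c ≤ 1)
    (h : ∀ ε, 0 < ε → Tendsto (fun n => (P n).real {ω | ε ≤ |X n ω - c|}) atTop (𝓝 0)) :
    Tendsto (fun n => ∫ ω, X n ω ∂P n) atTop (𝓝 c) := by
  rw [Metric.tendsto_nhds]
  intro ε hε
  filter_upwards [(h (ε / 2) (by positivity)).eventually (gt_mem_nhds (half_pos hε))] with n hn
  have hX : Integrable (X n) (P n) :=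
    .of_bound (hm n).aestronglyMeasurable 1 (.of_forall fun ω => by
      rw [Real.norm_of_nonneg (h0 n ω)]; exact h1 n ω)
  have hS : MeasurableSet {ω | ε / 2 ≤ |X n ω - c|} :=
    measurableSet_le measurable_const ((hm n).sub_const c).abs
  have hi : Integrable ({ω | ε / 2 ≤ |X n ω - c|}.indicator fun _ => (1 : ℝ)) (P n) :=
    (integrable_const 1).indicator hS
  -- Off the bad event the deviation is below `ε / 2`; on it, it is at most `1` because both values
  -- lie in `[0, 1]`.
  have hb : ∫ ω, |X n ω - c| ∂P n
      ≤ ∫ ω, (ε / 2 + {ω | ε / 2 ≤ |X n ω - c|}.indicator (fun _ => (1 : ℝ)) ω) ∂P n := by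
    refine integral_mono (hX.sub (integrable_const c)).abs ((integrable_const _).add hi) fun ω => ?_
    by_cases hω : ε / 2 ≤ |X n ω - c|
    · simp only [Set.indicator_apply, Set.mem_ofPred_eq, hω, if_true]
      have : |X n ω - c| ≤ 1 := abs_le.2 ⟨by linarith [h0 n ω], by linarith [h1 n ω]⟩
      linarith
    · simp only [Set.indicator_apply, Set.mem_ofPred_eq, hω, if_false]
      linarith
  rw [integral_add (integrable_const _) hi, integral_indicator hS] at hb
  simp only [integral_const, probReal_univ, smul_eq_mul, one_mul, mul_one,
    measureReal_restrict_apply_univ] at hb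
  have : ∫ ω, X n ω ∂P n - c = ∫ ω, (X n ω - c) ∂P n := by
    rw [integral_sub hX (integrable_const c)]; simp
  rw [Real.dist_eq, this]
  exact (abs_integral_le_integral_abs).trans_lt (by linarith)

theorem mainTheorem8 (p : ℕ → unitInterval)
    (hp : (fun n : ℕ => 1 / (n : ℝ)) =o[atTop] fun n : ℕ => (p n : ℝ))
    (hq : (fun n : ℕ => 1 / (n : ℝ)) =o[atTop] fun n : ℕ => 1 - (p n : ℝ)) :
    (∀ x : ℝ, Tendsto
      (fun n : ℕ => ∫ G, esd (scaledAdjMatrix_isHermitian (p n) G) x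
        ∂(SimpleGraph.binomialRandom (Fin n) (p n)))
      atTop (𝓝 (semicircleCDF x))) ∧
    (∀ x ε : ℝ, 0 < ε → Tendsto
      (fun n : ℕ => (SimpleGraph.binomialRandom (Fin n) (p n)).real
        {G | ε ≤ |esd (scaledAdjMatrix_isHermitian (p n) G) x - semicircleCDF x|})
      atTop (𝓝 0)) := by
  have hprob : ∀ x ε : ℝ, 0 < ε → Tendsto
      (fun n : ℕ => (SimpleGraph.binomialRandom (Fin n) (p n)).real
        {G | ε ≤ |esd (scaledAdjMatrix_isHermitian (p n) G) x - semicircleCDF x|})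
      atTop (𝓝 0) := by
    intro x ε hε
    -- The filter lives on `n + 1` vertices, as the empirical measure of an empty matrix is not a
    -- probability measure.
    rw [← tendsto_add_atTop_iff_nat 1]
    have h := Metric.tendsto_nhds.1 (tendsto_esd_scaledAdjMatrix hp hq x) ε hε
    rw [Filter.Eventually, mem_binomialRandomFilter] at h
    simpa only [Set.mem_ofPred_eq, not_lt, Real.dist_eq] using h
  refine ⟨fun x => ?_, hprob⟩
  exact tendsto_integral_of_tendsto_measureReal (fun n => measurable_of_finite _)
    (fun n G => esd_nonneg _ x) (fun n G => esd_le_one _ x) measureReal_nonneg measureReal_le_one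
    (hprob x)
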